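/- Let $A=(a_{ij})_{i,j\in I}$ be an affine Cartan matrix, i.e. an indecomposable symmetrizable generalized Cartan matrix with finite index set $I$ such that $Au=0$ for some vector $u$ with positive coordinates. Let $P=L\oplus Q$, where $L=\bigoplus_{i\in I}\mathbb{Z}\Lambda_i$ and $Q=\bigoplus_{i\in I}\mathbb{Z}\alpha_i$, and let the simple coroots $h_i\in\operatorname{Hom}(P,\mathbb{Z})$ be given by $\langle h_i,\alpha_j\rangle=a_{ij}$, $\langle h_i,\Lambda_j\rangle=\delta_{ij}$. Let $s_i(\lambda)=\lambda-\langle h_i,\lambda\rangle\alpha_i$; for $J\subset I$ let $W_J\subset\operatorname{Aut}(P)$ be the group generated by the $s_i$ ($i\in J$), and let $W=W_I$ be the Weyl group. Let $\delta=\sum_i a_i\alpha_i$ ($a_i\ge 0$) be the generator of $\{\alpha\in Q:\langle h_i,\alpha\rangle=0\ \forall i\}$, let $c=\sum_i a_i^\vee h_i$ ($a_i^\vee\ge0$) be the generator of $\{h\in\sum_i\mathbb{Z}h_i:\langle h,\alpha_i\rangle=0\ \forall i\}$, and let $(\ ,\ )\colon P\times P\to\mathbb{Q}$ be the symmetric bilinear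 form with $(L,L)=0$, $\langle h_i,\lambda\rangle=2(\alpha_i,\lambda)/(\alpha_i,\alpha_i)$ and $(\delta,\lambda)=\langle c,\lambda\rangle$ for $\lambda\in P$. Let $\Delta=\{w\alpha_i: w\in W,\ i\in I\}\cup\{n\delta: n\in\mathbb{Z}\setminus\{0\}\}$ be the set of roots. The group $W$ acts on the group ring $\mathbb{Z}[P]=\bigoplus_{\lambda\in P}\mathbb{Z}e^\lambda$ by $w e^\lambda=e^{w\lambda}$. Let $\lambda_0\in P$. (i) If $J\subsetneq I$, then $H^1(W_J,\mathbb{Z}[P])=0$. (ii) If $\langle c,\lambda_0\rangle\neq0$, and if either (a) $\lambda_0$ is not regular, i.e. $(\beta,\lambda_0)=0$ for some $\beta\in\Delta$, or (b) $|I|>2$, then $H^1\bigl(W,\bigoplus_{\lambda\in W\lambda_0}\mathbb{Z}e^\lambda\bigr)=0$. (iii) Let $0\in I$ be such that $a_0=1$ and the image of $W$ in $\operatorname{Aut}(Q/\mathbb{Z}\delta)$ is generated by the images of the $s_i$ with $i\in I\setminus\{0\}$. If $\langle c,\lambda_0\rangle=0$ and $\langle h_i,\lambda_0\rangle\ge0$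 for all $i\in I\setminus\{0\}$, then multiplication by $1-e^{\langle h_0,\lambda_0\rangle\delta}$ maps $\bigoplus_{\lambda\in W\lambda_0}\mathbb{Z}e^\lambda$ to itself, and the map it induces on $H^1\bigl(W,\bigoplus_{\lambda\in W\lambda_0}\mathbb{Z}e^\lambda\bigr)$ is the zero map. -/

import Mathlib

open CategoryTheory
open scoped Matrix

noncomputable section

/-- An affine Cartan matrix whose rows and columns are indexed by the finite set `I`:
an indecomposable symmetrizable generalized Cartan matrix which annihilates some vector all of
whose coordinates are positive. -/
structure AffineCartanMatrix (I : Type) [Fintype I] where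
  /-- the matrix `(a_{ij})` -/
  A : Matrix I I ℤ
  nonempty : Nonempty I
  diag : ∀ i, A i i = 2
  offDiag : ∀ i j, i ≠ j → A i j ≤ 0
  zero_symm : ∀ i j, A i j = 0 → A j i = 0
  indecomposable : ∀ J : Set I, J.Nonempty → Jᶜ.Nonempty → ∃ i ∈ J, ∃ j ∈ Jᶜ, A i j ≠ 0
  symmetrizable : ∃ d : I → ℤ, (∀ i, 0 < d i) ∧ ∀ i j, d i * A i j = d j * A j i
  exists_pos_null : ∃ u : I → ℤ, (∀ i, 0 < u i) ∧ A *ᵥ u = 0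

/-- `a` has nonnegative coordinates and generates the group of integral vectors `x` with
`B x = 0`. -/
def IsNullGenerator {I : Type} [Fintype I] (B : Matrix I I ℤ) (a : I → ℤ) : Prop :=
  (∀ i, 0 ≤ a i) ∧ ∀ x : I → ℤ, B *ᵥ x = 0 ↔ ∃ n : ℤ, x = n • a

theorem exists_isNullGenerator {I : Type} [Fintype I] (B : Matrix I I ℤ) [Nonempty I]
    (offDiag : ∀ i j, i ≠ j → B i j ≤ 0)
    (indec : ∀ J : Set I, J.Nonempty → Jᶜ.Nonempty → ∃ i ∈ J, ∃ j ∈ Jᶜ, B i j ≠ 0)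
    (hu : ∃ u : I → ℤ, (∀ i, 0 < u i) ∧ B *ᵥ u = 0) :
    ∃ a : I → ℤ, IsNullGenerator B a := by
  obtain ⟨u, hupos, hu⟩ := hu
  obtain ⟨a, hua, hgcd⟩ := Finset.extract_gcd (s := Finset.univ) u Finset.univ_nonempty
  set g := Finset.univ.gcd u with hg
  have hua' : u = g • a := by
    funext i; simpa using hua i (Finset.mem_univ i)
  have hg0 : 0 ≤ g := Int.nonneg_of_normalize_eq_self (by rw [hg]; exact Finset.normalize_gcd)
  have hapos : ∀ i, 0 < a i := by
    intro i
    have h1 := hupos i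
    rw [hua'] at h1
    simp only [Pi.smul_apply, smul_eq_mul] at h1
    exact pos_of_mul_pos_right h1 hg0
  have hgne : g ≠ 0 := by
    rintro h0
    obtain ⟨i⟩ := ‹Nonempty I›
    have h1 := hupos i
    rw [hua', h0] at h1
    simp at h1
  have ha : B *ᵥ a = 0 := by
    rw [hua', Matrix.mulVec_smul] at hu
    exact (smul_eq_zero.1 hu).resolve_left hgne
  refine ⟨a, fun i => (hapos i).le, fun x => ⟨fun hx => ?_, ?_⟩⟩
  · obtain ⟨i, -, hi⟩ := Finset.exists_min_image Finset.univ (fun j => (x j : ℚ) / a j)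
      Finset.univ_nonempty
    set y : I → ℤ := fun j => a i * x j - x i * a j with hy
    have hy0 : ∀ j, 0 ≤ y j := by
      intro j
      have h1 := hi j (Finset.mem_univ j)
      have hi' : (0 : ℚ) < a i := by exact_mod_cast hapos i
      have hj' : (0 : ℚ) < a j := by exact_mod_cast hapos j
      rw [div_le_div_iff₀ hi' hj'] at h1
      have h2 : x i * a j ≤ x j * a i := by exact_mod_cast h1
      simp only [hy]
      linarith
    have hBy : B *ᵥ y = 0 := by
      have : y = a i • x - x i • a := by funext j; simp [hy]
      rw [this, Matrix.mulVec_sub, Matrix.mulVec_smul, Matrix.mulVec_smul, hx, ha]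
      simp
    have hyz : ∀ j, y j = 0 := by
      by_contra! hne
      obtain ⟨j0, hj0⟩ := hne
      obtain ⟨k, hk, j, hj, hkj⟩ := indec {j | y j = 0} ⟨i, by simp [hy, mul_comm]⟩ ⟨j0, hj0⟩
      replace hk : y k = 0 := hk
      replace hj : ¬ y j = 0 := hj
      have hsum : ∑ l, B k l * y l = 0 := by
        have := congrFun hBy k
        simpa [Matrix.mulVec, dotProduct] using this
      have hterm : ∀ l ∈ Finset.univ, B k l * y l ≤ 0 := by
        intro l _
        by_cases hl : k = l
        · subst hl; simp [hk]
        · exact mul_nonpos_of_nonpos_of_nonneg (offDiag k l hl) (hy0 l)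
      have := (Finset.sum_eq_zero_iff_of_nonpos hterm).1 hsum j (Finset.mem_univ j)
      rcases mul_eq_zero.1 this with h | h
      · exact hkj h
      · exact hj h
    have hdvd : a i ∣ x i := by
      have h1 : a i ∣ Finset.univ.gcd (fun j => x i * a j) := by
        refine Finset.dvd_gcd fun j _ => ⟨x j, ?_⟩
        have := hyz j
        simp only [hy] at this
        linarith
      have h2 := (Finset.gcd_mul_left' (s := Finset.univ) (f := a) (x i)).dvd
      rw [hgcd, mul_one] at h2
      exact h1.trans h2
    obtain ⟨n, hn⟩ := hdvd
    refine ⟨n, funext fun j => ?_⟩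
    have := hyz j
    simp only [hy, hn] at this
    have h3 : a i * (x j - n * a j) = 0 := by linarith
    have h4 := (mul_eq_zero.1 h3).resolve_left (hapos i).ne'
    simp only [Pi.smul_apply, smul_eq_mul]
    linarith
  · rintro ⟨n, rfl⟩
    rw [Matrix.mulVec_smul, ha, smul_zero]

/-- The weight lattice `P = L ⊕ Q`: the first component is the vector of coordinates in the basis
`(Λ_i)` of `L`, the second one is the vector of coordinates in the basis `(α_i)` of `Q`. -/
abbrev WeightLattice (I : Type) : Type := (I → ℤ) × (I → ℤ)

/-- The group ring `ℤ[P]`; the element `e^μ` is `AddMonoidAlgebra.single μ 1`. -/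
abbrev WeightRing (I : Type) : Type := AddMonoidAlgebra ℤ (WeightLattice I)

namespace AffineCartanMatrix

variable {I : Type} [Fintype I] (C : AffineCartanMatrix I)

theorem exists_isNullGenerator_A : ∃ a : I → ℤ, IsNullGenerator C.A a :=
  have := C.nonempty
  exists_isNullGenerator C.A C.offDiag C.indecomposable C.exists_pos_null

theorem exists_pos_null_transpose : ∃ u : I → ℤ, (∀ i, 0 < u i) ∧ C.Aᵀ *ᵥ u = 0 := by
  obtain ⟨u, hu, hAu⟩ := C.exists_pos_null
  obtain ⟨d, hd, hsym⟩ := C.symmetrizable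
  refine ⟨fun i => d i * u i, fun i => mul_pos (hd i) (hu i), funext fun j => ?_⟩
  have h1 : ∑ i, C.A j i * u i = 0 := by
    simpa [Matrix.mulVec, dotProduct] using congrFun hAu j
  simp only [Matrix.mulVec, dotProduct, Matrix.transpose_apply, Pi.zero_apply]
  calc ∑ i, C.A i j * (d i * u i) = ∑ i, d j * (C.A j i * u i) :=
        Finset.sum_congr rfl fun i _ => by linear_combination u i * hsym i j
    _ = 0 := by rw [← Finset.mul_sum, h1, mul_zero]

theorem exists_isNullGenerator_transpose : ∃ a : I → ℤ, IsNullGenerator C.Aᵀ a := by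
  have := C.nonempty
  refine exists_isNullGenerator C.Aᵀ (fun i j h => C.offDiag j i h.symm) (fun J h1 h2 => ?_)
    C.exists_pos_null_transpose
  obtain ⟨i, hi, j, hj, h⟩ := C.indecomposable J h1 h2
  exact ⟨i, hi, j, hj, fun h0 => h (C.zero_symm j i h0)⟩

/-- The coefficients `a_i` of `δ = ∑ a_i α_i`. -/
def mark : I → ℤ := C.exists_isNullGenerator_A.choose

/-- The coefficients `a_i^∨` of `c = ∑ a_i^∨ h_i`. -/
def comark : I → ℤ := C.exists_isNullGenerator_transpose.choose

theorem mark_spec : IsNullGenerator C.A C.mark := C.exists_isNullGenerator_A.choose_spec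

theorem comark_spec : IsNullGenerator C.Aᵀ C.comark :=
  C.exists_isNullGenerator_transpose.choose_spec

theorem comark_pos (i : I) : 0 < C.comark i := by
  obtain ⟨u, hu, hAu⟩ := C.exists_pos_null_transpose
  obtain ⟨n, rfl⟩ := (C.comark_spec.2 u).1 hAu
  refine lt_of_le_of_ne (C.comark_spec.1 i) fun h => ?_
  have := hu i
  simp [← h] at this

theorem mark_pos (i : I) : 0 < C.mark i := by
  obtain ⟨u, hu, hAu⟩ := C.exists_pos_null
  obtain ⟨n, rfl⟩ := (C.mark_spec.2 u).1 hAu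
  refine lt_of_le_of_ne (C.mark_spec.1 i) fun h => ?_
  have := hu i
  simp [← h] at this

/-- The simple coroot `h_i`, as a linear form on `P`: `⟨h_i, Λ_j⟩ = δ_{ij}` and
`⟨h_i, α_j⟩ = a_{ij}`. -/
def coroot (i : I) : WeightLattice I →ₗ[ℤ] ℤ :=
  LinearMap.proj i ∘ₗ
    (LinearMap.fst ℤ (I → ℤ) (I → ℤ) + C.A.mulVecLin ∘ₗ LinearMap.snd ℤ (I → ℤ) (I → ℤ))

theorem coroot_apply (i : I) (μ : WeightLattice I) :
    C.coroot i μ = μ.1 i + (C.A *ᵥ μ.2) i := rfl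

/-- The canonical central element `c`, as a linear form on `P`. -/
def level : WeightLattice I →ₗ[ℤ] ℤ := ∑ i, C.comark i • C.coroot i

/-- The generator `δ = ∑ a_i α_i` of the null roots. -/
def delta : WeightLattice I := (0, C.mark)

theorem coroot_delta (i : I) : C.coroot i C.delta = 0 := by
  have h : C.A *ᵥ C.mark = 0 := (C.mark_spec.2 _).2 ⟨1, (one_smul _ _).symm⟩
  simp [coroot_apply, delta, h]

/-- The invariant bilinear form on `P`, normalized by `(δ, μ) = ⟨c, μ⟩` and `(L, L) = 0`. -/
def form : WeightLattice I →ₗ[ℤ] WeightLattice I →ₗ[ℤ] ℚ :=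
  LinearMap.mk₂ ℤ
    (fun μ ν => ∑ i, ((C.comark i : ℚ) / C.mark i) *
      (μ.2 i * C.coroot i ν + μ.1 i * ν.2 i))
    (fun μ μ' ν => by
      rw [← Finset.sum_add_distrib]
      exact Finset.sum_congr rfl fun i _ => by simp; ring)
    (fun n μ ν => by
      rw [Finset.smul_sum]
      exact Finset.sum_congr rfl fun i _ => by simp; ring)
    (fun μ ν ν' => by
      rw [← Finset.sum_add_distrib]
      exact Finset.sum_congr rfl fun i _ => by simp; ring)
    (fun n μ ν => by
      rw [Finset.smul_sum]
      exact Finset.sum_congr rfl fun i _ => by rw [map_smul]; simp; ring)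

theorem form_apply (μ ν : WeightLattice I) :
    C.form μ ν = ∑ i, ((C.comark i : ℚ) / C.mark i) *
      (μ.2 i * C.coroot i ν + μ.1 i * ν.2 i) := rfl

/-- The numbers `a_i^∨ / a_i` symmetrize the Cartan matrix. -/
theorem comark_div_mark_mul (i j : I) :
    ((C.comark i : ℚ) / C.mark i) * C.A i j = ((C.comark j : ℚ) / C.mark j) * C.A j i := by
  obtain ⟨d, hd, hsym⟩ := C.symmetrizable
  have hA : C.A *ᵥ C.mark = 0 := (C.mark_spec.2 _).2 ⟨1, (one_smul _ _).symm⟩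
  have hv : C.Aᵀ *ᵥ (fun i => d i * C.mark i) = 0 := by
    funext k
    have h1 : ∑ l, C.A k l * C.mark l = 0 := by
      simpa [Matrix.mulVec, dotProduct] using congrFun hA k
    simp only [Matrix.mulVec, dotProduct, Matrix.transpose_apply, Pi.zero_apply]
    calc ∑ l, C.A l k * (d l * C.mark l) = ∑ l, d k * (C.A k l * C.mark l) :=
          Finset.sum_congr rfl fun l _ => by linear_combination C.mark l * hsym l k
      _ = 0 := by rw [← Finset.mul_sum, h1, mul_zero]
  obtain ⟨n, hn⟩ := (C.comark_spec.2 _).1 hv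
  have hn' : ∀ k, (d k : ℚ) * C.mark k = n * C.comark k := fun k => by
    exact_mod_cast (by simpa using congrFun hn k : d k * C.mark k = n * C.comark k)
  have hm : ∀ k, (C.mark k : ℚ) ≠ 0 := fun k => by exact_mod_cast (C.mark_pos k).ne'
  have hn0 : (n : ℚ) ≠ 0 := by
    intro h0
    have h1 := hn' i
    rw [h0, zero_mul] at h1
    have h2 : (d i : ℚ) ≠ 0 := by exact_mod_cast (hd i).ne'
    exact mul_ne_zero h2 (hm i) h1
  have hq : ∀ k, (C.comark k : ℚ) / C.mark k = d k / n := fun k => by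
    rw [div_eq_div_iff (hm k) hn0]
    linarith [hn' k]
  have hs : (d i : ℚ) * C.A i j = d j * C.A j i := by exact_mod_cast hsym i j
  rw [hq, hq, div_mul_eq_mul_div, div_mul_eq_mul_div, hs]

theorem form_comm (μ ν : WeightLattice I) : C.form μ ν = C.form ν μ := by
  have key : ∀ x y : I → ℤ,
      ∑ i, ((C.comark i : ℚ) / C.mark i) * (x i * ((C.A *ᵥ y) i : ℤ)) =
      ∑ i, ((C.comark i : ℚ) / C.mark i) * (y i * ((C.A *ᵥ x) i : ℤ)) := by
    intro x y
    simp only [Matrix.mulVec, dotProduct, Int.cast_sum, Int.cast_mul, Finset.mul_sum]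
    rw [Finset.sum_comm]
    refine Finset.sum_congr rfl fun i _ => Finset.sum_congr rfl fun j _ => ?_
    linear_combination (x j * y i : ℚ) * C.comark_div_mark_mul j i
  have split : ∀ μ ν : WeightLattice I, C.form μ ν =
      ∑ i, ((C.comark i : ℚ) / C.mark i) * (μ.2 i * ((C.A *ᵥ ν.2) i : ℤ)) +
      ∑ i, ((C.comark i : ℚ) / C.mark i) * (μ.2 i * ν.1 i + μ.1 i * ν.2 i) := by
    intro μ ν
    rw [form_apply, ← Finset.sum_add_distrib]
    refine Finset.sum_congr rfl fun i _ => ?_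
    rw [coroot_apply]
    push_cast
    ring
  rw [split, split, key]
  congr 1
  exact Finset.sum_congr rfl fun i _ => by ring

theorem form_fundamental (x y : I → ℤ) :
    C.form ((x, 0) : WeightLattice I) ((y, 0) : WeightLattice I) = 0 := by
  simp [form_apply]

theorem form_delta (μ : WeightLattice I) : C.form C.delta μ = C.level μ := by
  have hm : ∀ k, (C.mark k : ℚ) ≠ 0 := fun k => by exact_mod_cast (C.mark_pos k).ne'
  rw [form_apply, level]
  simp only [LinearMap.sum_apply, LinearMap.smul_apply, smul_eq_mul, Int.cast_sum, Int.cast_mul]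
  refine Finset.sum_congr rfl fun i _ => ?_
  have := hm i
  simp only [delta, Pi.zero_apply, Int.cast_zero, zero_mul, add_zero]
  field_simp

variable [DecidableEq I]

/-- The simple root `α_i`. -/
def simpleRoot (i : I) : WeightLattice I := (0, Pi.single i 1)

theorem coroot_simpleRoot (i j : I) : C.coroot i (simpleRoot j) = C.A i j := by
  simp [coroot_apply, simpleRoot]

theorem coroot_fundamental (i j : I) :
    C.coroot i (Pi.single j 1, 0) = if i = j then 1 else 0 := by
  simp [coroot_apply, Pi.single_apply]

/-- The simple reflection `s_i : μ ↦ μ - ⟨h_i, μ⟩ α_i` of `P`. -/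
def reflection (i : I) : WeightLattice I ≃ₗ[ℤ] WeightLattice I :=
  Module.reflection (x := simpleRoot i) (f := C.coroot i)
    ((C.coroot_simpleRoot i i).trans (C.diag i))

theorem reflection_apply (i : I) (μ : WeightLattice I) :
    C.reflection i μ = μ - C.coroot i μ • simpleRoot i := rfl

/-- The group `W_J` generated by the simple reflections `s_i`, `i ∈ J`. -/
def parabolic (J : Set I) : Subgroup (WeightLattice I ≃ₗ[ℤ] WeightLattice I) :=
  Subgroup.closure (C.reflection '' J)

/-- The Weyl group `W`. -/
abbrev weylGroup : Subgroup (WeightLattice I ≃ₗ[ℤ] WeightLattice I) := C.parabolic Set.univ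

theorem apply_delta {w : WeightLattice I ≃ₗ[ℤ] WeightLattice I} (hw : w ∈ C.weylGroup) :
    w C.delta = C.delta := by
  induction hw using Subgroup.closure_induction with
  | mem x hx =>
    obtain ⟨i, -, rfl⟩ := hx
    simp [reflection_apply, coroot_delta]
  | one => rfl
  | mul x y _ _ hx hy => rw [LinearEquiv.mul_apply, hy, hx]
  | inv x _ hx =>
    have : x⁻¹ (x C.delta) = C.delta := x.symm_apply_apply _
    rwa [hx] at this

theorem form_simpleRoot (i : I) (ν : WeightLattice I) :
    C.form (simpleRoot i) ν = ((C.comark i : ℚ) / C.mark i) * C.coroot i ν := by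
  rw [form_apply, Finset.sum_eq_single i]
  · simp [simpleRoot]
  · intro j _ hj
    simp [simpleRoot, hj]
  · simp

theorem coroot_eq_form (i : I) (μ : WeightLattice I) :
    (C.coroot i μ : ℚ) =
      2 * C.form (simpleRoot i) μ / C.form (simpleRoot i) (simpleRoot i) := by
  have h1 : (C.mark i : ℚ) ≠ 0 := by exact_mod_cast (C.mark_pos i).ne'
  have h2 : (C.comark i : ℚ) ≠ 0 := by exact_mod_cast (C.comark_pos i).ne'
  rw [form_simpleRoot, form_simpleRoot, coroot_simpleRoot, C.diag]
  push_cast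
  field_simp

/-- The set `Δ` of roots of the affine Lie algebra: the real roots `w α_i` and the imaginary roots
`n δ`, `n ≠ 0`. -/
def roots : Set (WeightLattice I) :=
  {β | (∃ w ∈ C.weylGroup, ∃ i, β = w (simpleRoot i)) ∨ ∃ n : ℤ, n ≠ 0 ∧ β = n • C.delta}

/-- A weight is regular if no root is orthogonal to it. -/
def IsRegular (μ : WeightLattice I) : Prop := ∀ β ∈ C.roots, C.form β μ ≠ 0

/-- The requirements on the distinguished vertex `o` (the vertex `0`): `a_o = 1`, and every element
of the Weyl group acts on `Q / ℤ δ` in the same way as some element of the group generated by the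
`s_i` with `i ≠ o`. -/
def IsZeroVertex (o : I) : Prop :=
  C.mark o = 1 ∧ ∀ w ∈ C.weylGroup, ∃ w' ∈ C.parabolic {o}ᶜ, ∀ q : I → ℤ, ∃ n : ℤ,
    w ((0, q) : WeightLattice I) - w' ((0, q) : WeightLattice I) = n • C.delta

/-- The action of `W_J` on `ℤ[P]`, given by `w e^μ = e^{w μ}`. -/
def weightRingRepresentation (J : Set I) :
    Representation ℤ (C.parabolic J) (WeightRing I) where
  toFun w := (AddMonoidAlgebra.domCongr ℤ ℤ
    (w : WeightLattice I ≃ₗ[ℤ] WeightLattice I).toAddEquiv).toLinearMap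
  map_one' := by
    refine LinearMap.ext fun x => ?_
    exact DFunLike.congr_fun (AddMonoidAlgebra.domCongr_refl (R := ℤ) (A := ℤ) (M := WeightLattice I)) x
  map_mul' v w := by
    refine LinearMap.ext fun x => ?_
    exact (DFunLike.congr_fun (AddMonoidAlgebra.trans_domCongr_domCongr (R := ℤ) (A := ℤ)
      (w : WeightLattice I ≃ₗ[ℤ] WeightLattice I).toAddEquiv
      (v : WeightLattice I ≃ₗ[ℤ] WeightLattice I).toAddEquiv) x).symm

theorem weightRingRepresentation_apply (J : Set I) (w : C.parabolic J) (x : WeightRing I) :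
    C.weightRingRepresentation J w x = AddMonoidAlgebra.domCongr ℤ ℤ
      (w : WeightLattice I ≃ₗ[ℤ] WeightLattice I).toAddEquiv x := rfl

theorem weightRingRepresentation_single (J : Set I) (w : C.parabolic J) (μ : WeightLattice I)
    (n : ℤ) : C.weightRingRepresentation J w (AddMonoidAlgebra.single μ n) =
      AddMonoidAlgebra.single (w.1 μ) n :=
  AddMonoidAlgebra.domCongr_single (R := ℤ) (A := ℤ) w.1.toAddEquiv μ n

/-- The `W_J`-module `ℤ[P]`. -/
abbrev weightRingRep (J : Set I) : Rep ℤ (C.parabolic J) :=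
  Rep.of (C.weightRingRepresentation J)

/-- The submodule `⨁_{μ ∈ W λ} ℤ e^μ` of `ℤ[P]`. -/
def orbitSubmodule (lam : WeightLattice I) : Submodule ℤ (WeightRing I) :=
  Submodule.span ℤ (Set.range fun w : C.weylGroup => AddMonoidAlgebra.single (w.1 lam) 1)

theorem orbitSubmodule_le_comap (lam : WeightLattice I) (w : C.weylGroup) :
    C.orbitSubmodule lam ≤
      (C.orbitSubmodule lam).comap (C.weightRingRepresentation Set.univ w) := by
  refine Submodule.span_le.2 ?_
  rintro _ ⟨v, rfl⟩
  refine Submodule.subset_span ⟨w * v, ?_⟩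
  exact (C.weightRingRepresentation_single Set.univ w (v.1 lam) 1).symm

/-- The `W`-module `⨁_{μ ∈ W λ} ℤ e^μ`. -/
abbrev orbitRep (lam : WeightLattice I) : Rep ℤ C.weylGroup :=
  Rep.of ((C.weightRingRepresentation Set.univ).subrepresentation (C.orbitSubmodule lam)
    (C.orbitSubmodule_le_comap lam))

/-- The element `1 - e^{n δ}` of `ℤ[P]`. -/
def oneSubExp (n : ℤ) : WeightRing I := 1 - AddMonoidAlgebra.single (n • C.delta) 1

theorem weightRingRepresentation_oneSubExp_mul (n : ℤ) (w : C.weylGroup) (x : WeightRing I) :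
    C.weightRingRepresentation Set.univ w (C.oneSubExp n * x) =
      C.oneSubExp n * C.weightRingRepresentation Set.univ w x := by
  have h : w.1.toAddEquiv (n • C.delta) = n • C.delta := by
    rw [map_zsmul]
    exact congrArg (n • ·) (C.apply_delta w.2)
  rw [weightRingRepresentation_apply, weightRingRepresentation_apply, map_mul, oneSubExp, map_sub,
    map_one, AddMonoidAlgebra.domCongr_single, h]

/-- Multiplication by `1 - e^{n δ}`, as an endomorphism of the `W`-module `⨁_{μ ∈ W λ} ℤ e^μ`,
when it preserves this submodule of `ℤ[P]`. -/
def orbitMul (lam : WeightLattice I) (n : ℤ)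
    (h : ∀ x ∈ C.orbitSubmodule lam, C.oneSubExp n * x ∈ C.orbitSubmodule lam) :
    C.orbitRep lam ⟶ C.orbitRep lam :=
  Rep.ofHom
    { (LinearMap.mulLeft ℤ (C.oneSubExp n)).restrict h with
      isIntertwining' := fun w => LinearMap.ext fun x => Subtype.ext
        (C.weightRingRepresentation_oneSubExp_mul n w x.1).symm }

end AffineCartanMatrix

end

/-! Coefficient by coefficient, a cocycle with values in `ℤ[P]` or in an orbit module is a cocycle
with values in integral functions on a `W`-set. The problem is to write it as the coboundary of a
function of finite support.

For (i), the form on `Q` is positive semidefinite with radical spanned by `δ`, and for proper `J`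
the group `W_J` moves weights transversally to `δ`, so it is finite (`finite_parabolic`). For a
finite group, summing the cocycle over the group and dividing by the order with rounding gives the
required function (`exists_eq_of_finite`).

For (ii), nonzero level makes stabilizers finite. A homomorphism from a finite group to `ℤ` is zero,
so the cocycle is the coboundary of some function `φ` on the orbit, with no control on supports
(`exists_eq_of_finite_stabilizer`). Each `s_i` changes `φ` at finitely many points only, and the
claim becomes that `φ` is constant off a finite set: the graph of the orbit under simple reflections
has one end. This is `exists_finite_setOf_ne_of_confluent`, applied to a signed height with finite
sublevel sets (`finite_setOf_depth_le`). Every weight can be raised, and two different raisings of a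
weight must be connected strictly above it. If `|I| > 2`, the two reflections generate a finite
dihedral group and its orbits provide the connection (`orbit_confluent`). If `|I| = 2` and the
weight is not regular, no weight of the orbit has two raisings (`not_coroot_pos_of_not_isRegular`).

For (iii), on level zero `s_o` is an element `w` of the finite Weyl group followed by a shift along
`δ`. Hence `s_o w⁻¹` and its conjugates under the finite Weyl group shift along `δ`, and they
commute. Subtract a coboundary so that the cocycle vanishes on the finite Weyl group. Commutation
then exhibits `1 - e^{nδ}` times the cocycle, where `n = ⟨h_o, λ⟩`, as the coboundary of a function
invariant under the finite Weyl group (`exists_eq_of_vanishing_on_finiteWeylGroup`). -/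

noncomputable section

/-! ### Cocycles with values in integral functions -/

section Cocycles

variable {G X : Type*} [Group G] [MulAction G X]

/-- A `1`-cocycle of `G` with values in the integral functions on the `G`-set `X`. -/
def IsFunctionCocycle (f : G → X → ℤ) : Prop :=
  ∀ g h x, f (g * h) x = f g x + f h (g⁻¹ • x)

namespace IsFunctionCocycle

variable {f : G → X → ℤ}

theorem map_one (hf : IsFunctionCocycle f) (x : X) : f 1 x = 0 := by
  have := hf 1 1 x
  simp at this
  exact this

theorem sub_coboundary (hf : IsFunctionCocycle f) (m : X → ℤ) :
    IsFunctionCocycle fun g x => f g x - (m (g⁻¹ • x) - m x) := by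
  intro g h x
  simp only [hf g h x, mul_inv_rev, mul_smul]
  ring

/-- A cocycle of a finite group with values in the integral functions on a set is the coboundary
of a function whose support is controlled by the supports of the values of the cocycle. -/
theorem exists_eq_of_finite [Finite G] (hf : IsFunctionCocycle f) :
    ∃ m : X → ℤ, (∀ g x, f g x = m (g⁻¹ • x) - m x) ∧ ∀ x, m x ≠ 0 → ∃ g, f g x ≠ 0 := by
  have := Fintype.ofFinite G
  set M : X → ℤ := fun x => ∑ h, f h x with hM
  set n : ℤ := (Fintype.card G : ℤ) with hn
  have hn0 : n ≠ 0 := by rw [hn]; exact_mod_cast Fintype.card_ne_zero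
  have key : ∀ g x, M x = n * f g x + M (g⁻¹ • x) := by
    intro g x
    simp only [hM]
    rw [← Equiv.sum_comp (Equiv.mulLeft g) (fun h => f h x)]
    simp only [Equiv.coe_mulLeft, hf g _ x, Finset.sum_add_distrib, Finset.sum_const,
      Finset.card_univ, nsmul_eq_mul, hn]
  -- The values of `M` along an orbit are congruent modulo `n` by `key`, so floor division by `n`
  -- still turns `key` into an exact coboundary relation over `ℤ`.
  refine ⟨fun x => -(M x / n), fun g x => ?_, fun x hx => ?_⟩
  · change f g x = -(M (g⁻¹ • x) / n) - -(M x / n)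
    rw [key g x, add_comm, Int.add_mul_ediv_left _ _ hn0]
    ring
  · by_contra! h
    simp [hM, h] at hx

/-- A coboundary is itself a cocycle, and the cocycle rule propagates equality from generators to
products and inverses. -/
theorem eq_coboundary_of_closure {S : Set G} (hS : Subgroup.closure S = ⊤)
    (hf : IsFunctionCocycle f) {m : X → ℤ}
    (h : ∀ s ∈ S, ∀ x, f s x = m (s⁻¹ • x) - m x) (g : G) (x : X) :
    f g x = m (g⁻¹ • x) - m x := by
  have hg : g ∈ Subgroup.closure S := hS ▸ Subgroup.mem_top g
  induction hg using Subgroup.closure_induction generalizing x with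
  | mem s hs => exact h s hs x
  | one => simp [hf.map_one]
  | mul a b _ _ ha hb => rw [hf, ha, hb, mul_inv_rev, mul_smul]; ring
  | inv a _ ha =>
    have h1 := hf a a⁻¹ (a • x)
    have h2 := ha (a • x)
    simp only [mul_inv_cancel, hf.map_one, inv_smul_smul] at h1 h2
    rw [inv_inv]
    linarith

/-- On a transitive `G`-set whose stabilizers are finite, cocycles are coboundaries of functions
without finiteness conditions. -/
theorem exists_eq_of_finite_stabilizer (hf : IsFunctionCocycle f) (x₀ : X)
    (htrans : ∀ x : X, ∃ g : G, x = g • x₀) [Finite (MulAction.stabilizer G x₀)] :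
    ∃ φ : X → ℤ, ∀ g x, f g x = φ (g⁻¹ • x) - φ x := by
  -- Restricted to the stabilizer and evaluated at `x₀`, the cocycle is a homomorphism to `ℤ`; it
  -- vanishes because elements of the stabilizer have finite order.
  have hstab : ∀ s : G, s • x₀ = x₀ → f s x₀ = 0 := by
    intro s hs
    have hpow : ∀ n : ℕ, f (s ^ n) x₀ = n * f s x₀ := by
      intro n
      induction n with
      | zero => simp [hf.map_one]
      | succ n ih =>
        have hfix : (s ^ n)⁻¹ • x₀ = x₀ :=
          ((MulAction.stabilizer G x₀).inv_mem ((MulAction.stabilizer G x₀).pow_mem hs n))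
        rw [pow_succ, hf, hfix, ih]
        push_cast
        ring
    obtain ⟨n, hn, h1⟩ := isOfFinOrder_iff_pow_eq_one.1
      (isOfFinOrder_of_finite (⟨s, hs⟩ : MulAction.stabilizer G x₀))
    have h2 : s ^ n = 1 := congrArg Subtype.val h1
    have h3 := hpow n
    rw [h2, hf.map_one] at h3
    rcases mul_eq_zero.1 h3.symm with h | h
    · exact absurd h (by exact_mod_cast hn.ne')
    · exact h
  -- Thus `f g (g • x₀)` depends only on the point `g • x₀`; its negative is the primitive.
  have hwell : ∀ g h : G, g • x₀ = h • x₀ → f g (g • x₀) = f h (h • x₀) := by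
    intro g h hgh
    have h1 := hf h (h⁻¹ * g) (g • x₀)
    rw [mul_inv_cancel_left, hgh, inv_smul_smul, hstab _ (by
      rw [mul_smul, hgh, inv_smul_smul]), add_zero, ← hgh] at h1
    rw [h1, hgh]
  choose r hr using htrans
  refine ⟨fun x => -f (r x) x, fun g x => ?_⟩
  have h1 := hwell (r (g⁻¹ • x)) (g⁻¹ * r x) (by rw [← hr, mul_smul, ← hr])
  have h2 := hf g (g⁻¹ * r x) x
  rw [← hr, mul_smul, ← hr] at h1
  rw [mul_inv_cancel_left] at h2
  linarith

end IsFunctionCocycle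

end Cocycles

/-! ### Cocycle criteria for the vanishing of `H1` and of maps on it -/

section Representations

open groupCohomology

variable {G : Type} [Group G]

theorem subsingleton_H1_of_forall_cocycle (A : Rep ℤ G)
    (h : ∀ f : G → A, (∀ g k, f (g * k) = A.ρ g (f k) + f g) → ∃ m : A, ∀ g, f g = A.ρ g m - m) :
    Subsingleton (H1 A) := by
  refine subsingleton_of_forall_eq 0 fun x => ?_
  induction x using H1_induction_on with
  | h x =>
    rw [H1π_eq_zero_iff]
    obtain ⟨m, hm⟩ := h x ((mem_cocycles₁_iff _).1 x.2)
    exact ⟨m, funext fun g => (hm g).symm⟩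

theorem functor_one_map_eq_zero {A B : Rep ℤ G} (φ : A ⟶ B)
    (h : ∀ f : G → A, (∀ g k, f (g * k) = A.ρ g (f k) + f g) →
      ∃ m : B, ∀ g, φ.hom (f g) = B.ρ g m - m) :
    (groupCohomology.functor ℤ G 1).map φ = 0 := by
  ext x
  induction x using H1_induction_on with
  | h x =>
    obtain ⟨m, hm⟩ := h x ((mem_cocycles₁_iff _).1 x.2)
    have h1 := H1π_comp_map_apply (MonoidHom.id G) φ x
    refine h1.trans ?_
    refine (H1π_eq_zero_iff _).2 ⟨m, funext fun g => (hm g).symm⟩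

end Representations

/-! ### Coefficients in the group ring and in orbit modules -/

theorem AffineCartanMatrix.oneSubExp_mul_coeff {I : Type} [Fintype I] (C : AffineCartanMatrix I)
    (n : ℤ) (x : WeightRing I) (μ : WeightLattice I) :
    (C.oneSubExp n * x).coeff μ = x.coeff μ - x.coeff (μ - n • C.delta) := by
  rw [oneSubExp, sub_mul, one_mul, AddMonoidAlgebra.coeff_sub, Finsupp.sub_apply]
  rw [AddMonoidAlgebra.coeff_single_mul_apply, one_mul, neg_add_eq_sub]

namespace AffineCartanMatrix

variable {I : Type} [Fintype I] [DecidableEq I] (C : AffineCartanMatrix I)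

theorem weightRingRepresentation_coeff (J : Set I) (w : C.parabolic J) (x : WeightRing I)
    (μ : WeightLattice I) :
    (C.weightRingRepresentation J w x).coeff μ = x.coeff (w⁻¹ • μ) := by
  rw [weightRingRepresentation_apply, AddMonoidAlgebra.coeff_domCongr]
  rfl

theorem mem_orbitSubmodule_iff (lam : WeightLattice I) (x : WeightRing I) :
    x ∈ C.orbitSubmodule lam ↔ ∀ μ, x.coeff μ ≠ 0 → μ ∈ MulAction.orbit C.weylGroup lam := by
  constructor
  · intro hx
    induction hx using Submodule.span_induction with
    | mem x hx =>
      obtain ⟨w, rfl⟩ := hx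
      intro μ hμ
      refine ⟨w, ?_⟩
      by_contra hne
      exact hμ (Finsupp.single_eq_of_ne fun h => hne h.symm)
    | zero => simp
    | add x y _ _ hx hy =>
      intro μ hμ
      by_cases h : x.coeff μ = 0
      · exact hy μ fun h' => hμ (by simp [h, h'])
      · exact hx μ h
    | smul a x _ hx =>
      intro μ hμ
      exact hx μ fun h' => hμ (by
        rw [AddMonoidAlgebra.coeff_smul, Finsupp.smul_apply, h', smul_zero])
  · intro hx
    rw [show x = ∑ μ ∈ x.coeff.support, x.coeff μ • AddMonoidAlgebra.single μ (1 : ℤ) by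
      conv_lhs => rw [← AddMonoidAlgebra.sum_coeff_single x]
      simp [Finsupp.sum]]
    refine Submodule.sum_mem _ fun μ hμ => Submodule.smul_mem _ _ (Submodule.subset_span ?_)
    obtain ⟨w, rfl⟩ := hx μ (Finsupp.mem_support_iff.1 hμ)
    exact ⟨w, rfl⟩

end AffineCartanMatrix

/-! ### Semidefiniteness of the affine form and finiteness of integral points -/

/-- A positive definite quadratic function, perturbed by a linear one, takes bounded values at
finitely many integral points only. -/
theorem finite_setOf_posDef_add_linear_le {ι : Type*} [Fintype ι] (N : (ι → ℝ) → ℝ)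
    (hcont : Continuous N) (hsmul : ∀ (t : ℝ) x, N (t • x) = t ^ 2 * N x)
    (hpos : ∀ x, x ≠ 0 → 0 < N x) (m : (ι → ℝ) →ₗ[ℝ] ℝ) (c : ℝ) :
    {q : ι → ℤ | N (fun i => (q i : ℝ)) + m (fun i => (q i : ℝ)) ≤ c}.Finite := by
  -- The constant `ε` is the minimum of `N` on the unit sphere, spread to all vectors by
  -- homogeneity.
  obtain ⟨ε, hε, hN⟩ : ∃ ε > 0, ∀ x, ε * ‖x‖ ^ 2 ≤ N x := by
    rcases isEmpty_or_nonempty ι with h | h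
    · refine ⟨1, one_pos, fun x => ?_⟩
      have : x = (0 : ℝ) • x := Subsingleton.elim _ _
      rw [this, hsmul]
      simp
    have hne : (Metric.sphere (0 : ι → ℝ) 1).Nonempty := NormedSpace.sphere_nonempty.2 zero_le_one
    obtain ⟨x₀, hx₀, hmin⟩ := (isCompact_sphere (0 : ι → ℝ) 1).exists_isMinOn hne hcont.continuousOn
    have hx₀' : x₀ ≠ 0 := by
      rintro rfl
      simp at hx₀
    refine ⟨N x₀, hpos _ hx₀', fun x => ?_⟩
    by_cases hx : x = 0
    · subst hx
      have := hsmul 0 0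
      simp at this
      simp [this]
    · have hx' : ‖x‖ ≠ 0 := norm_ne_zero_iff.2 hx
      have h1 : N x₀ ≤ N (‖x‖⁻¹ • x) := hmin (by simp [norm_smul, hx'])
      rw [hsmul, inv_pow, ← div_eq_inv_mul, le_div_iff₀ (by positivity)] at h1
      exact h1
  set K : ℝ := ‖m.toContinuousLinearMap‖ with hK
  have hm : ∀ x, -(K * ‖x‖) ≤ m x := fun x => by
    have := m.toContinuousLinearMap.le_opNorm x
    exact neg_le_of_abs_le this
  obtain ⟨R, hR⟩ : ∃ R : ℕ, ∀ t : ℝ, 0 ≤ t → ε * t ^ 2 - K * t ≤ c → t ≤ R := by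
    obtain ⟨R, hR⟩ := exists_nat_gt ((K + |c| + ε) / ε)
    refine ⟨R, fun t ht h => ?_⟩
    by_contra! hlt
    have hK0 : 0 ≤ K := norm_nonneg _
    have hc := abs_nonneg c
    have hc' := le_abs_self c
    have h1 : K + |c| + ε < t * ε := by
      rw [← div_lt_iff₀ hε]
      exact hR.trans hlt
    have h2 : 1 < t := by
      by_contra! h2
      nlinarith
    nlinarith
  classical
  refine (Set.finite_Icc (fun _ : ι => -(R : ℤ)) (fun _ => (R : ℤ))).subset fun q hq => ?_
  set x : ι → ℝ := fun i => (q i : ℝ) with hx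
  have h1 : ‖x‖ ≤ R := hR _ (norm_nonneg _) (by
    have := hN x
    have := hm x
    have : N x + m x ≤ c := hq
    linarith)
  have h2 : ∀ i, |q i| ≤ (R : ℤ) := fun i => by
    have h3 : |(q i : ℝ)| ≤ R := (norm_le_pi_norm x i).trans h1
    exact_mod_cast h3
  exact ⟨fun i => (abs_le.1 (h2 i)).1, fun i => (abs_le.1 (h2 i)).2⟩

namespace AffineCartanMatrix

section

variable {I : Type} [Fintype I] (C : AffineCartanMatrix I)

/-- The real number `(α_i, α_j)`. -/
def gram (i j : I) : ℝ := (C.comark i : ℝ) / C.mark i * C.A i j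

theorem gram_comm (i j : I) : C.gram i j = C.gram j i := by
  have := C.comark_div_mark_mul i j
  simp only [gram]
  exact_mod_cast congrArg (Rat.cast : ℚ → ℝ) this

theorem sum_gram_mul_mark (i : I) : ∑ j, C.gram i j * C.mark j = 0 := by
  have h : C.A *ᵥ C.mark = 0 := (C.mark_spec.2 _).2 ⟨1, (one_smul _ _).symm⟩
  have h1 : ∑ l, C.A i l * C.mark l = 0 := by
    simpa [Matrix.mulVec, dotProduct] using congrFun h i
  simp only [gram, mul_assoc]
  rw [← Finset.mul_sum]
  rw [show ∑ l, (C.A i l : ℝ) * C.mark l = 0 by exact_mod_cast h1, mul_zero]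

theorem mark_real_pos (i : I) : (0 : ℝ) < C.mark i := by exact_mod_cast C.mark_pos i

theorem comark_real_pos (i : I) : (0 : ℝ) < C.comark i := by exact_mod_cast C.comark_pos i

theorem gram_nonpos {i j : I} (h : i ≠ j) : C.gram i j ≤ 0 := by
  have := C.mark_real_pos i
  have := C.comark_real_pos i
  have : (C.A i j : ℝ) ≤ 0 := by exact_mod_cast C.offDiag i j h
  exact mul_nonpos_of_nonneg_of_nonpos (by positivity) this

/-- Expand the squares: the pure terms `x_i²` cancel because the Gram matrix kills the vector of
marks. Off-diagonal entries are nonpositive and diagonal terms vanish, so this is a sum of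
nonnegative terms. -/
theorem sum_gram_eq (x : I → ℝ) :
    ∑ i, ∑ j, C.gram i j * (x i * x j) = ∑ i, ∑ j,
      -(C.gram i j * C.mark i * C.mark j / 2) * (x i / C.mark i - x j / C.mark j) ^ 2 := by
  have hm := fun i => (C.mark_real_pos i).ne'
  have h1 : ∑ i, ∑ j, C.gram i j * C.mark j * (x i ^ 2 / C.mark i) = 0 := by
    refine Finset.sum_eq_zero fun i _ => ?_
    rw [← Finset.sum_mul, C.sum_gram_mul_mark, zero_mul]
  have h2 : ∑ i, ∑ j, C.gram i j * C.mark i * (x j ^ 2 / C.mark j) = 0 := by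
    rw [Finset.sum_comm, ← h1]
    exact Finset.sum_congr rfl fun i _ => Finset.sum_congr rfl fun j _ => by rw [C.gram_comm]
  have h3 : ∑ i, ∑ j,
      -(C.gram i j * C.mark i * C.mark j / 2) * (x i / C.mark i - x j / C.mark j) ^ 2 =
      ∑ i, ∑ j, C.gram i j * (x i * x j) -
      (∑ i, ∑ j, C.gram i j * C.mark j * (x i ^ 2 / C.mark i) +
        ∑ i, ∑ j, C.gram i j * C.mark i * (x j ^ 2 / C.mark j)) / 2 := by
    rw [← Finset.sum_add_distrib, Finset.sum_div, ← Finset.sum_sub_distrib]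
    refine Finset.sum_congr rfl fun i _ => ?_
    rw [← Finset.sum_add_distrib, Finset.sum_div, ← Finset.sum_sub_distrib]
    refine Finset.sum_congr rfl fun j _ => ?_
    have := hm i
    have := hm j
    field_simp
    ring
  rw [h3, h1, h2]
  ring

theorem sum_gram_term_nonneg (x : I → ℝ) (i j : I) :
    0 ≤ -(C.gram i j * C.mark i * C.mark j / 2) * (x i / C.mark i - x j / C.mark j) ^ 2 := by
  by_cases h : i = j
  · subst h; simp
  · have h1 := C.gram_nonpos h
    have h2 := mul_pos (C.mark_real_pos i) (C.mark_real_pos j)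
    have h3 : C.gram i j * C.mark i * C.mark j ≤ 0 := by
      rw [mul_assoc]; exact mul_nonpos_of_nonpos_of_nonneg h1 h2.le
    exact mul_nonneg (by linarith) (sq_nonneg _)

theorem sum_gram_nonneg (x : I → ℝ) : 0 ≤ ∑ i, ∑ j, C.gram i j * (x i * x j) := by
  rw [sum_gram_eq]
  exact Finset.sum_nonneg fun i _ => Finset.sum_nonneg fun j _ => C.sum_gram_term_nonneg x i j

/-- The radical of the form on `Q ⊗ ℝ` is spanned by `δ`. -/
theorem exists_eq_of_sum_gram_eq_zero {x : I → ℝ}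
    (hx : ∑ i, ∑ j, C.gram i j * (x i * x j) = 0) : ∃ t : ℝ, ∀ i, x i = t * C.mark i := by
  obtain ⟨o⟩ := C.nonempty
  have hm := fun i => C.mark_real_pos i
  rw [sum_gram_eq, Finset.sum_eq_zero_iff_of_nonneg fun i _ => Finset.sum_nonneg fun j _ =>
    C.sum_gram_term_nonneg x i j] at hx
  refine ⟨x o / C.mark o, fun i => ?_⟩
  rw [← div_eq_iff (hm i).ne']
  by_contra hne
  -- If the ratio `x_k / a_k` were not constant, indecomposability would give a nonzero entry
  -- between two vertices with different ratios, hence a nonzero square term.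
  obtain ⟨k, hk, l, hl, hkl⟩ := C.indecomposable {k | x k / C.mark k = x o / C.mark o} ⟨o, rfl⟩
    ⟨i, hne⟩
  replace hk : x k / C.mark k = x o / C.mark o := hk
  replace hl : ¬ x l / C.mark l = x o / C.mark o := hl
  have h1 := (Finset.sum_eq_zero_iff_of_nonneg fun j _ => C.sum_gram_term_nonneg x k j).1
    (hx k (Finset.mem_univ k)) l (Finset.mem_univ l)
  rcases mul_eq_zero.1 h1 with h | h
  · have hkl' : (C.A k l : ℝ) ≠ 0 := by exact_mod_cast hkl
    have := C.comark_real_pos k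
    have := hm k
    have := hm l
    have hg : C.gram k l ≠ 0 := mul_ne_zero (by positivity) hkl'
    have : C.gram k l * C.mark k * C.mark l ≠ 0 :=
      mul_ne_zero (mul_ne_zero hg (hm k).ne') (hm l).ne'
    apply this
    linarith
  · rw [hk] at h
    exact hl (by linarith [pow_eq_zero_iff (two_ne_zero) |>.1 h])

theorem form_root_root (q r : I → ℤ) :
    ((C.form ((0, q) : WeightLattice I) ((0, r) : WeightLattice I) : ℚ) : ℝ) =
      ∑ i, ∑ j, C.gram i j * (q i * r j) := by
  rw [form_apply]
  push_cast
  refine Finset.sum_congr rfl fun i _ => ?_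
  simp only [coroot_apply, Matrix.mulVec, dotProduct, gram]
  push_cast
  simp only [Pi.zero_apply, Int.cast_zero, zero_mul, add_zero, zero_add]
  rw [Finset.mul_sum, Finset.mul_sum]
  refine Finset.sum_congr rfl fun j _ => ?_
  ring

theorem form_root_nonneg (q : I → ℤ) :
    0 ≤ C.form ((0, q) : WeightLattice I) ((0, q) : WeightLattice I) := by
  have := C.sum_gram_nonneg (fun i => (q i : ℝ))
  rw [← form_root_root] at this
  exact_mod_cast this

/-- A multiple of `δ` with one vanishing coordinate is zero, since all marks are positive; so `q` is
outside the radical. -/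
theorem form_root_pos {q : I → ℤ} (hq : q ≠ 0) {k : I} (hk : q k = 0) :
    0 < C.form ((0, q) : WeightLattice I) ((0, q) : WeightLattice I) := by
  refine lt_of_le_of_ne (C.form_root_nonneg q) fun h => hq ?_
  have h1 : ∑ i, ∑ j, C.gram i j * ((q i : ℝ) * q j) = 0 := by
    rw [← form_root_root, ← h, Rat.cast_zero]
  obtain ⟨t, ht⟩ := C.exists_eq_of_sum_gram_eq_zero (x := fun i => (q i : ℝ)) h1
  have h2 := ht k
  have h3 : t = 0 := by
    simp only [hk, Int.cast_zero] at h2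
    exact (mul_eq_zero.1 h2.symm).resolve_right (C.mark_real_pos k).ne'
  funext i
  have := ht i
  rw [h3, zero_mul] at this
  exact_mod_cast this

/-- The level is a combination of the coroots with positive coefficients. With `ε` the sign of the
level, this says that every weight of the orbit can be raised. -/
theorem exists_coroot_pos {ε : ℤ} {μ : WeightLattice I} (h : 0 < ε * C.level μ) :
    ∃ i, 0 < ε * C.coroot i μ := by
  by_contra! hle
  have h1 : ε * C.level μ = ∑ i, C.comark i * (ε * C.coroot i μ) := by
    simp only [level, LinearMap.sum_apply, LinearMap.smul_apply, smul_eq_mul, Finset.mul_sum]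
    exact Finset.sum_congr rfl fun i _ => by ring
  have h2 : ε * C.level μ ≤ 0 := by
    rw [h1]
    exact Finset.sum_nonpos fun i _ =>
      mul_nonpos_of_nonneg_of_nonpos (C.comark_pos i).le (hle i)
  omega

end

section

variable {I : Type} [Fintype I] [DecidableEq I] (C : AffineCartanMatrix I)

theorem linearMap_apply_eq_sum (f : (I → ℤ) →ₗ[ℤ] ℚ) (q : I → ℤ) :
    f q = ∑ i, (q i : ℚ) * f (Pi.single i 1) := by
  conv_lhs => rw [pi_eq_sum_univ' q]
  rw [map_sum]
  refine Finset.sum_congr rfl fun i _ => ?_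
  rw [map_smul, zsmul_eq_mul]

/-- The form degenerates only along `δ`; adding the square of a linear form that is nonzero on `δ`
makes it positive definite. -/
theorem finite_setOf_form_add_sq_add_le (l m : (I → ℤ) →ₗ[ℤ] ℚ) (hl : l C.mark ≠ 0) (c : ℚ) :
    {q : I → ℤ | C.form ((0, q) : WeightLattice I) ((0, q) : WeightLattice I) + l q ^ 2 + m q
      ≤ c}.Finite := by
  set l' : (I → ℝ) →ₗ[ℝ] ℝ := ∑ i, (l (Pi.single i 1) : ℝ) • LinearMap.proj i with hl'
  set m' : (I → ℝ) →ₗ[ℝ] ℝ := ∑ i, (m (Pi.single i 1) : ℝ) • LinearMap.proj i with hm'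
  have hl1 : ∀ q : I → ℤ, l' (fun i => (q i : ℝ)) = l q := fun q => by
    rw [linearMap_apply_eq_sum l]
    simp [hl', mul_comm]
  have hm1 : ∀ q : I → ℤ, m' (fun i => (q i : ℝ)) = m q := fun q => by
    rw [linearMap_apply_eq_sum m]
    simp [hm', mul_comm]
  refine (finite_setOf_posDef_add_linear_le
    (fun x => ∑ i, ∑ j, C.gram i j * (x i * x j) + l' x ^ 2) ?_ ?_ ?_ m' c).subset ?_
  · have : Continuous l' := l'.continuous_of_finiteDimensional
    fun_prop
  · intro t x
    rw [mul_add, Finset.mul_sum, map_smul, smul_eq_mul, mul_pow]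
    congr 1
    refine Finset.sum_congr rfl fun i _ => ?_
    rw [Finset.mul_sum]
    refine Finset.sum_congr rfl fun j _ => ?_
    simp only [Pi.smul_apply, smul_eq_mul]
    ring
  · intro x hx
    have h1 := C.sum_gram_nonneg x
    refine lt_of_le_of_ne (by positivity) fun h0 => hx ?_
    have h2 : ∑ i, ∑ j, C.gram i j * (x i * x j) = 0 := by nlinarith [sq_nonneg (l' x)]
    obtain ⟨t, ht⟩ := C.exists_eq_of_sum_gram_eq_zero h2
    have h3 : l' x = 0 := by
      rw [h2, zero_add] at h0
      exact pow_eq_zero_iff two_ne_zero |>.1 h0.symm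
    have h4 : x = t • fun i => (C.mark i : ℝ) := funext ht
    rw [h4, map_smul, hl1, smul_eq_mul] at h3
    have h5 : t = 0 := (mul_eq_zero.1 h3).resolve_right (by exact_mod_cast hl)
    rw [h4, h5, zero_smul]
  · intro q hq
    have : C.form ((0, q) : WeightLattice I) ((0, q) : WeightLattice I) + l q ^ 2 + m q ≤ c := hq
    change ∑ i, ∑ j, C.gram i j * ((q i : ℝ) * q j) + l' (fun i => (q i : ℝ)) ^ 2 +
      m' (fun i => (q i : ℝ)) ≤ c
    rw [hl1, hm1, ← form_root_root]
    exact_mod_cast this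

end

end AffineCartanMatrix

/-! ### Invariance of the form, finite subgroups, and depth on an orbit -/

namespace AffineCartanMatrix

section

variable {I : Type} [Fintype I] (C : AffineCartanMatrix I)

/-- The linear form `q ↦ (μ, q)` on `Q`. -/
def pairing (μ : WeightLattice I) : (I → ℤ) →ₗ[ℤ] ℚ :=
  C.form μ ∘ₗ LinearMap.inr ℤ (I → ℤ) (I → ℤ)

theorem pairing_apply (μ : WeightLattice I) (q : I → ℤ) :
    C.pairing μ q = C.form μ ((0, q) : WeightLattice I) := rfl

theorem pairing_mark (μ : WeightLattice I) : C.pairing μ C.mark = C.level μ := by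
  rw [← form_delta, form_comm]
  rfl

theorem form_root_delta (q : I → ℤ) : C.form ((0, q) : WeightLattice I) C.delta = 0 := by
  rw [form_apply]
  exact Finset.sum_eq_zero fun i _ => by rw [coroot_delta]; simp

/-- The height `∑ q_i` of `∑ q_i α_i`. -/
def height : (I → ℤ) →ₗ[ℤ] ℤ := ∑ i, LinearMap.proj i

theorem height_apply (q : I → ℤ) : height q = ∑ i, q i := by simp [height]

theorem height_mark_pos : 0 < height C.mark := by
  rw [height_apply]
  have := C.nonempty
  exact Finset.sum_pos (fun i _ => C.mark_pos i) Finset.univ_nonempty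

end

variable {I : Type} [Fintype I] [DecidableEq I] (C : AffineCartanMatrix I)

theorem parabolic_mono {J K : Set I} (h : J ⊆ K) : C.parabolic J ≤ C.parabolic K :=
  Subgroup.closure_mono (Set.image_mono h)

theorem parabolic_le_weylGroup (J : Set I) : C.parabolic J ≤ C.weylGroup :=
  C.parabolic_mono (Set.subset_univ J)

theorem reflection_mem_parabolic {J : Set I} {i : I} (hi : i ∈ J) :
    C.reflection i ∈ C.parabolic J := Subgroup.subset_closure ⟨i, hi, rfl⟩

theorem reflection_reflection (i : I) (μ : WeightLattice I) :
    C.reflection i (C.reflection i μ) = μ := Module.involutive_reflection _ μ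

theorem form_reflection (i : I) (μ ν : WeightLattice I) :
    C.form (C.reflection i μ) (C.reflection i ν) = C.form μ ν := by
  have h1 : ∀ ν, C.form ν (simpleRoot i) = ((C.comark i : ℚ) / C.mark i) * C.coroot i ν :=
    fun ν => by rw [form_comm, form_simpleRoot]
  simp only [reflection_apply, map_sub, LinearMap.sub_apply, map_zsmul, LinearMap.smul_apply,
    form_simpleRoot, h1, coroot_simpleRoot, C.diag]
  simp only [zsmul_eq_mul]
  push_cast
  ring

theorem form_apply_apply {w : WeightLattice I ≃ₗ[ℤ] WeightLattice I} (hw : w ∈ C.weylGroup)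
    (μ ν : WeightLattice I) : C.form (w μ) (w ν) = C.form μ ν := by
  induction hw using Subgroup.closure_induction generalizing μ ν with
  | mem x hx =>
    obtain ⟨i, -, rfl⟩ := hx
    exact C.form_reflection i μ ν
  | one => rfl
  | mul x y _ _ hx hy => rw [LinearEquiv.mul_apply, LinearEquiv.mul_apply, hx, hy]
  | inv x _ hx =>
    have h : ∀ μ, x (x⁻¹ μ) = μ := x.apply_symm_apply
    rw [← hx, h, h]

/-- An element of `W_J` changes a weight by an element of the span of the `α_j`, `j ∈ J`. -/
theorem exists_apply_eq_add {J : Set I} {w : WeightLattice I ≃ₗ[ℤ] WeightLattice I}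
    (hw : w ∈ C.parabolic J) (μ : WeightLattice I) :
    ∃ q : I → ℤ, w μ = μ + ((0, q) : WeightLattice I) ∧ ∀ o ∉ J, q o = 0 := by
  induction hw using Subgroup.closure_induction generalizing μ with
  | mem x hx =>
    obtain ⟨i, hi, rfl⟩ := hx
    refine ⟨-(C.coroot i μ • Pi.single i 1), ?_, fun o ho => ?_⟩
    · rw [reflection_apply, simpleRoot, sub_eq_add_neg]
      congr 1
      ext <;> simp
    · have : o ≠ i := fun h => ho (h ▸ hi)
      simp [this]
  | one => exact ⟨0, by simp, fun _ _ => rfl⟩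
  | mul x y _ _ hx hy =>
    obtain ⟨q, hq, hq'⟩ := hy μ
    obtain ⟨r, hr, hr'⟩ := hx (y μ)
    refine ⟨q + r, ?_, fun o ho => by simp [hq' o ho, hr' o ho]⟩
    rw [LinearEquiv.mul_apply, hr, hq, add_assoc]
    congr 1
  | inv x _ hx =>
    obtain ⟨q, hq, hq'⟩ := hx (x⁻¹ μ)
    refine ⟨-q, ?_, fun o ho => by simp [hq' o ho]⟩
    have h : x (x⁻¹ μ) = μ := x.apply_symm_apply μ
    rw [h] at hq
    have h2 : ((0, -q) : WeightLattice I) = -(0, q) := by ext <;> simp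
    rw [h2]
    exact eq_add_neg_of_add_eq hq.symm

theorem level_apply {w : WeightLattice I ≃ₗ[ℤ] WeightLattice I} (hw : w ∈ C.weylGroup)
    (μ : WeightLattice I) : C.level (w μ) = C.level μ := by
  have h := C.form_apply_apply hw C.delta μ
  rw [C.apply_delta hw, form_delta, form_delta] at h
  exact_mod_cast h

/-- This is `(wμ, wμ) = (μ, μ)` expanded; it puts the displacements of an orbit on a paraboloid, the
source of all finiteness below. -/
theorem form_add_two_pairing_eq_zero {w : WeightLattice I ≃ₗ[ℤ] WeightLattice I}
    (hw : w ∈ C.weylGroup) {μ : WeightLattice I} {q : I → ℤ}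
    (hq : w μ = μ + ((0, q) : WeightLattice I)) :
    C.form ((0, q) : WeightLattice I) ((0, q) : WeightLattice I) + 2 * C.pairing μ q = 0 := by
  have h := C.form_apply_apply hw μ μ
  rw [hq, map_add, map_add, LinearMap.add_apply, LinearMap.add_apply,
    C.form_comm ((0, q) : WeightLattice I) μ] at h
  rw [pairing_apply]
  linarith

/-- A group of elements of the Weyl group which move all weights inside a hyperplane transversal
to `δ` is finite. -/
theorem finite_of_transversal (H : Subgroup (WeightLattice I ≃ₗ[ℤ] WeightLattice I))
    (hH : H ≤ C.weylGroup) (l : (I → ℤ) →ₗ[ℤ] ℚ) (hl : l C.mark ≠ 0)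
    (h : ∀ w ∈ H, ∀ μ q, w μ = μ + ((0, q) : WeightLattice I) → l q = 0) : Finite H := by
  have hfin : ∀ μ : WeightLattice I, {ν | ∃ w ∈ H, ν = w μ}.Finite := by
    intro μ
    refine ((C.finite_setOf_form_add_sq_add_le l ((2 : ℤ) • C.pairing μ) hl 0).image
      fun q => μ + ((0, q) : WeightLattice I)).subset ?_
    rintro _ ⟨w, hw, rfl⟩
    obtain ⟨q, hq, -⟩ := C.exists_apply_eq_add (hH hw) μ
    refine ⟨q, ?_, hq.symm⟩
    have h1 := C.form_add_two_pairing_eq_zero (hH hw) hq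
    have h2 := h w hw μ q hq
    simp only [Set.mem_ofPred_eq, h2, LinearMap.smul_apply, zsmul_eq_mul]
    push_cast
    linarith
  -- An element of `H` is determined by the images of the basis `Λ_i`, `α_i`, and each of these has
  -- finitely many possible values.
  set b : I ⊕ I → WeightLattice I :=
    Sum.elim (fun i => (Pi.single i 1, 0)) (fun i => (0, Pi.single i 1)) with hb
  have := fun j => (hfin (b j)).to_subtype
  refine Finite.of_injective
    (fun (w : H) (j : I ⊕ I) => (⟨w.1 (b j), w.1, w.2, rfl⟩ : {ν | ∃ w ∈ H, ν = w (b j)}))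
    fun v w hvw => Subtype.ext (LinearEquiv.toLinearMap_injective ?_)
  have hj : ∀ j, v.1 (b j) = w.1 (b j) := fun j => congrArg Subtype.val (congrFun hvw j)
  refine LinearMap.prod_ext ?_ ?_
  · refine LinearMap.pi_ext' fun i => LinearMap.ext_ring ?_
    exact hj (Sum.inl i)
  · refine LinearMap.pi_ext' fun i => LinearMap.ext_ring ?_
    exact hj (Sum.inr i)

/-- Elements of `W_J` never change the `α_o`-coordinate for `o ∉ J`, while `δ` has a positive one:
that coordinate is the transversal linear form. -/
theorem finite_parabolic {J : Set I} (hJ : J ≠ Set.univ) : Finite (C.parabolic J) := by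
  obtain ⟨o, ho⟩ := (Set.ne_univ_iff_exists_notMem J).1 hJ
  refine C.finite_of_transversal _ (C.parabolic_le_weylGroup J)
    ((Int.castAddHom ℚ).toIntLinearMap ∘ₗ LinearMap.proj o) ?_ fun w hw μ q hq => ?_
  · simpa using (C.mark_pos o).ne'
  · obtain ⟨r, hr, hr'⟩ := C.exists_apply_eq_add hw μ
    have : q = r := (Prod.ext_iff.1 (add_left_cancel (hq.symm.trans hr))).2
    simp [this, hr' o ho]

/-- If `w` fixes `λ`, then `(λ, wμ - μ) = 0` for all `μ`. The transversal form is pairing with `λ`,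
whose value on `δ` is the level. -/
theorem finite_stabilizer {lam : WeightLattice I} (hlam : C.level lam ≠ 0) :
    Finite (MulAction.stabilizer C.weylGroup lam) := by
  have h : Finite ((MulAction.stabilizer C.weylGroup lam).map C.weylGroup.subtype) := by
    refine C.finite_of_transversal _ (Subgroup.map_subtype_le _) (C.pairing lam) ?_ ?_
    · rw [pairing_mark]
      exact_mod_cast hlam
    · rintro _ ⟨w, hw, rfl⟩ μ q hq
      have h1 : w.1 lam = lam := hw
      have h2 := C.form_apply_apply w.2 lam μ
      have h3 : w.1 μ = μ + ((0, q) : WeightLattice I) := hq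
      rw [h1, h3, map_add] at h2
      rw [pairing_apply]
      linarith
  exact Finite.of_equiv _ ((MulAction.stabilizer C.weylGroup lam).equivMapOfInjective
    C.weylGroup.subtype Subtype.val_injective).symm.toEquiv

/-- With `ε` the sign of the level, the paraboloid of displacements opens in one direction along
`δ`. This bounds the signed height on one side; the depth condition bounds it on the other, and what
remains is finite by definiteness transversally to `δ`. -/
theorem finite_setOf_depth_le {lam : WeightLattice I} {ε : ℤ} (hε : 0 < ε * C.level lam) (N : ℤ) :
    {μ ∈ MulAction.orbit C.weylGroup lam | -(ε * height μ.2) ≤ N}.Finite := by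
  set k : ℚ := (C.level lam : ℚ) with hk
  set h : ℚ := (height C.mark : ℚ) with hh
  set t : (I → ℤ) →ₗ[ℤ] ℚ := (Int.castAddHom ℚ).toIntLinearMap ∘ₗ height with ht
  have ht1 : ∀ q, t q = height q := fun q => rfl
  have hε' : (0 : ℚ) < ε * k := by rw [hk]; exact_mod_cast hε
  have hk0 : k ≠ 0 := by rintro h0; simp [h0] at hε'
  have hε0 : ε ≠ 0 := by rintro rfl; simp at hε'
  have hh0 : 0 < h := by rw [hh]; exact_mod_cast C.height_mark_pos
  have htm : t C.mark ≠ 0 := hh0.ne'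
  set Q : (I → ℤ) → ℚ := fun q => C.form ((0, q) : WeightLattice I) ((0, q) : WeightLattice I)
    with hQ
  set p := C.pairing lam with hp
  set D : Set (I → ℤ) := {q | Q q + 2 * p q = 0} with hD
  -- Project `q` along `δ` to `q' = h q - t(q) δ`, of height zero. Then `Q(q') + 2h (λ, q') = -2hk
  -- t(q)`, which is nonpositive when `ε t(q) ≥ 0`. So only finitely many `q'` occur, and the same
  -- identity recovers `t(q)` from `q'`.
  have hbound : ∃ B : ℚ, ∀ q ∈ D, 0 ≤ ε * t q → ε * t q ≤ B := by
    have hF := C.finite_setOf_form_add_sq_add_le t ((2 * height C.mark) • p) htm 0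
    obtain ⟨B, hB⟩ := (hF.image fun q => -ε * (Q q + 2 * h * p q) / (2 * k * h)).bddAbove
    refine ⟨B, fun q hq hq' => hB ⟨height C.mark • q - height q • C.mark, ?_, ?_⟩⟩
    all_goals
      have hq0 : Q q + 2 * p q = 0 := hq
      have hpm : p C.mark = k := C.pairing_mark lam
      have h1 : p (height C.mark • q - height q • C.mark) = h * p q - t q * k := by
        rw [map_sub, map_zsmul, map_zsmul, hpm, zsmul_eq_mul, zsmul_eq_mul]
        rfl
      have h2 : Q (height C.mark • q - height q • C.mark) = h ^ 2 * Q q := by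
        have e : ((0, height C.mark • q - height q • C.mark) : WeightLattice I) =
            height C.mark • ((0, q) : WeightLattice I) - height q • C.delta := by
          ext <;> simp [delta]
        have e2 : C.form (0, q) C.delta = 0 := C.form_root_delta q
        have e1 : C.form C.delta (0, q) = 0 := by rw [form_comm, e2]
        have e3 : C.form C.delta C.delta = 0 := C.form_root_delta C.mark
        simp only [hQ]
        rw [e]
        simp only [map_sub, map_zsmul, LinearMap.sub_apply, LinearMap.smul_apply, e1, e2, e3]
        simp only [zsmul_eq_mul, hh]
        ring
      have h3 : t (height C.mark • q - height q • C.mark) = 0 := by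
        rw [map_sub, map_zsmul, map_zsmul, zsmul_eq_mul, zsmul_eq_mul, ht1, ht1]
        ring
    · have h4 : Q (height C.mark • q - height q • C.mark) +
          t (height C.mark • q - height q • C.mark) ^ 2 +
          ((2 * height C.mark) • p) (height C.mark • q - height q • C.mark) ≤ 0 := by
        rw [LinearMap.smul_apply, h1, h2, h3, zsmul_eq_mul]
        push_cast
        rw [← hh]
        have h5 : h ^ 2 * Q q + 0 ^ 2 + 2 * h * (h * p q - t q * k) = -(2 * h * (k * t q)) := by
          linear_combination h ^ 2 * hq0
        have h6 : 0 ≤ k * t q := by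
          have h7 : (0 : ℚ) ≤ (ε : ℚ) ^ 2 * (k * t q) := by
            have := mul_nonneg hε'.le hq'
            linarith
          have h8 : (0 : ℚ) < (ε : ℚ) ^ 2 := by positivity
          exact nonneg_of_mul_nonneg_right h7 h8
        rw [h5]
        have : 0 ≤ 2 * h * (k * t q) := by positivity
        linarith
      exact h4
    · change -ε * (Q _ + 2 * h * p _) / (2 * k * h) = ε * t q
      rw [h1, h2]
      field_simp
      linear_combination -h * hq0
  obtain ⟨B, hB⟩ := hbound
  set M : ℚ := max |(N : ℚ) + ε * height lam.2| |B| with hM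
  refine ((C.finite_setOf_form_add_sq_add_le t ((2 : ℤ) • p) htm (M ^ 2)).image
    fun q => lam + ((0, q) : WeightLattice I)).subset ?_
  rintro _ ⟨⟨w, rfl⟩, hd⟩
  obtain ⟨q, hq, -⟩ := C.exists_apply_eq_add w.2 lam
  refine ⟨q, ?_, hq.symm⟩
  have hqD := C.form_add_two_pairing_eq_zero w.2 hq
  have h1 : -(ε * (height lam.2 + t q)) ≤ N := by
    have h2 : -(ε * height (w.1 lam).2) ≤ N := hd
    rw [hq, Prod.snd_add, map_add] at h2
    rw [ht1]
    exact_mod_cast h2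
  have h3 : |ε * t q| ≤ M := by
    rcases le_total 0 (ε * t q) with h4 | h4
    · rw [abs_of_nonneg h4]
      exact (hB q hqD h4).trans ((le_abs_self B).trans (le_max_right _ _))
    · rw [abs_of_nonpos h4]
      refine le_trans ?_ ((le_abs_self _).trans (le_max_left _ _))
      linarith
  have h4 : (ε * t q) ^ 2 ≤ M ^ 2 := sq_le_sq' (abs_le.1 h3).1 (abs_le.1 h3).2
  have h5 : (1 : ℚ) ≤ (ε : ℚ) ^ 2 := by
    have : 0 < ε ^ 2 := by positivity
    exact_mod_cast this
  have h6 : t q ^ 2 ≤ M ^ 2 := by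
    rw [mul_pow] at h4
    nlinarith [sq_nonneg (t q)]
  change Q q + t q ^ 2 + ((2 : ℤ) • p) q ≤ M ^ 2
  rw [LinearMap.smul_apply, zsmul_eq_mul]
  have hqD' : Q q + 2 * p q = 0 := hqD
  push_cast
  linarith

end AffineCartanMatrix

/-! ### Confluence and one-endedness -/

section Combinatorics

/-- The two ways around the orbit of a dominant regular weight under a finite dihedral Weyl group
meet at the antidominant weight; `a`, `b` are the negatives of the off-diagonal Cartan entries. -/
theorem rank_two_confluence {a b p q : ℤ} (ha : 0 ≤ a) (hb : 0 ≤ b) (hab : a = 0 ↔ b = 0)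
    (h4 : a * b < 4) (hp : 0 < p) (hq : 0 < q) (ψ : ℤ → ℤ → ℤ)
    (h1 : ∀ u v u', u' = p - u + a * v → 0 < u + v → 0 < u' + v → ψ u' v = ψ u v)
    (h2 : ∀ u v v', v' = q - v + b * u → 0 < u + v → 0 < u + v' → ψ u v' = ψ u v) :
    ψ p 0 = ψ 0 q := by
  -- The case `a = 1`, with `b = 1, 2, 3` (types `A₂`, `B₂`, `G₂`). The rewrites follow both
  -- alternating chains of reflections to their common end, the image under the longest element;
  -- every intermediate point has `u + v > 0`.
  have aux : ∀ {b p q : ℤ}, 1 ≤ b → b < 4 → 0 < p → 0 < q → ∀ ψ : ℤ → ℤ → ℤ,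
      (∀ u v u', u' = p - u + v → 0 < u + v → 0 < u' + v → ψ u' v = ψ u v) →
      (∀ u v v', v' = q - v + b * u → 0 < u + v → 0 < u + v' → ψ u v' = ψ u v) →
      ψ p 0 = ψ 0 q := by
    intro b p q hb1 hb4 hp hq ψ h1 h2
    obtain rfl | rfl | rfl : b = 1 ∨ b = 2 ∨ b = 3 := by omega
    · rw [← h2 p 0 (q + p) (by ring) (by omega) (by omega),
        ← h1 p (q + p) (q + p) (by ring) (by omega) (by omega),
        ← h1 0 q (q + p) (by ring) (by omega) (by omega),
        ← h2 (q + p) q (q + p) (by ring) (by omega) (by omega)]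
    · rw [← h2 p 0 (q + 2 * p) (by ring) (by omega) (by omega),
        ← h1 p (q + 2 * p) (q + 2 * p) (by ring) (by omega) (by omega),
        ← h2 (q + 2 * p) (q + 2 * p) (2 * q + 2 * p) (by ring) (by omega) (by omega),
        ← h1 0 q (q + p) (by ring) (by omega) (by omega),
        ← h2 (q + p) q (2 * q + 2 * p) (by ring) (by omega) (by omega),
        ← h1 (q + p) (2 * q + 2 * p) (q + 2 * p) (by ring) (by omega) (by omega)]
    · rw [← h2 p 0 (q + 3 * p) (by ring) (by omega) (by omega),
        ← h1 p (q + 3 * p) (q + 3 * p) (by ring) (by omega) (by omega),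
        ← h2 (q + 3 * p) (q + 3 * p) (3 * q + 6 * p) (by ring) (by omega) (by omega),
        ← h1 (q + 3 * p) (3 * q + 6 * p) (2 * q + 4 * p) (by ring) (by omega) (by omega),
        ← h2 (2 * q + 4 * p) (3 * q + 6 * p) (4 * q + 6 * p) (by ring) (by omega) (by omega),
        ← h1 0 q (q + p) (by ring) (by omega) (by omega),
        ← h2 (q + p) q (3 * q + 3 * p) (by ring) (by omega) (by omega),
        ← h1 (q + p) (3 * q + 3 * p) (2 * q + 3 * p) (by ring) (by omega) (by omega),
        ← h2 (2 * q + 3 * p) (3 * q + 3 * p) (4 * q + 6 * p) (by ring) (by omega) (by omega),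
        ← h1 (2 * q + 3 * p) (4 * q + 6 * p) (2 * q + 4 * p) (by ring) (by omega) (by omega)]
  rcases ha.eq_or_lt with rfl | ha'
  · obtain rfl := hab.1 rfl
    rw [← h2 p 0 q (by ring) (by omega) (by omega), ← h1 0 q p (by ring) (by omega) (by omega)]
  have hb' : 0 < b := lt_of_le_of_ne hb fun h => ha'.ne' (hab.2 h.symm)
  rcases (show 1 ≤ a from ha').eq_or_lt with rfl | ha2
  · refine aux hb' (by linarith) hp hq ψ ?_ h2
    simpa using h1
  -- Here `a ≥ 2` and `a * b < 4` force `b = 1`, so `aux` applies with the two reflections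
  -- exchanged.
  · obtain rfl : b = 1 := by nlinarith
    refine (aux ha' (by linarith) hq hp (fun u v => ψ v u) ?_ ?_).symm
    · intro u v u' hu h h'
      exact h2 v u u' (by rw [hu]; ring) (by omega) (by omega)
    · intro u v v' hv h h'
      exact h1 v u v' hv (by omega) (by omega)

/-- A connectivity criterion: on a transitive `G`-set with a depth function whose sublevel sets are
finite, functions which are almost invariant under the generators are almost constant, provided
that the generators raising the depth can be interchanged. -/
theorem exists_finite_setOf_ne_of_confluent {G X ι : Type*} [Group G] [MulAction G X] [Finite ι]
    (s : ι → G) (hs : Subgroup.closure (Set.range s) = ⊤) (x₀ : X)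
    (htrans : ∀ x : X, ∃ g : G, x = g • x₀) (hinv : ∀ i (x : X), s i • s i • x = x)
    (d : X → ℤ) (h : X → ι → ℤ) (hd : ∀ i x, d (s i • x) = d x + h x i)
    (hfix : ∀ i x, h x i = 0 → s i • x = x) (hfin : ∀ N, {x | d x ≤ N}.Finite)
    (hup : ∀ x, ∃ i, 0 < h x i)
    (hconf : ∀ x i j, i ≠ j → 0 < h x i → 0 < h x j → ∀ φ : X → ℤ,
      (∀ y k, d x < d y → d x < d (s k • y) → φ (s k • y) = φ y) → φ (s i • x) = φ (s j • x))
    (φ : X → ℤ) (hφ : ∀ i, {x | φ (s i • x) ≠ φ x}.Finite) : ∃ c, {x | φ x ≠ c}.Finite := by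
  obtain ⟨N₀, hN₀⟩ : ∃ N₀, ∀ x, N₀ ≤ d x := by
    obtain ⟨B, hB⟩ := ((hfin 0).image d).bddBelow
    refine ⟨min B 0, fun x => ?_⟩
    rcases le_total (d x) 0 with hx | hx
    · exact (min_le_left _ _).trans (hB ⟨x, hx, rfl⟩)
    · exact (min_le_right _ _).trans hx
  -- Induction on the depth threshold above which `φ` is exactly invariant under the generators; at
  -- threshold `N₀`, the minimal depth, invariance is global and transitivity gives a constant.
  have key : ∀ (n : ℕ) (φ : X → ℤ),
      (∀ y k, N₀ + n ≤ d y → N₀ + n ≤ d (s k • y) → φ (s k • y) = φ y) →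
      ∃ c, {x | φ x ≠ c}.Finite := by
    intro n
    induction n with
    | zero =>
      intro φ hφ
      refine ⟨φ x₀, ?_⟩
      have hg : ∀ g : G, ∀ x, φ (g • x) = φ x := by
        intro g
        have hg : g ∈ Subgroup.closure (Set.range s) := hs ▸ Subgroup.mem_top g
        induction hg using Subgroup.closure_induction with
        | mem a ha =>
          obtain ⟨i, rfl⟩ := ha
          exact fun x => hφ x i (by simpa using hN₀ x) (by simpa using hN₀ _)
        | one => simp
        | mul a b _ _ ha hb => intro x; rw [mul_smul, ha, hb]
        | inv a _ ha => intro x; rw [← ha, smul_inv_smul]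
      convert Set.finite_empty
      ext x
      obtain ⟨g, rfl⟩ := htrans x
      simp [hg]
    | succ n ih =>
      intro φ hφ
      choose r hr using hup
      -- Correct `φ` on the single layer of depth `N₀ + n` by copying the value at a raised
      -- neighbour. Confluence makes the copied value independent of the neighbour, so `φ'` is
      -- invariant one layer lower, and it differs from `φ` at finitely many points.
      set φ' : X → ℤ := fun x => if d x = N₀ + n then φ (s (r x) • x) else φ x with hφ'
      have hne : ∀ x, d x ≠ N₀ + n → φ' x = φ x := fun x hx => if_neg hx
      have heq : ∀ y k, d y = N₀ + n → N₀ + n ≤ d (s k • y) → φ' (s k • y) = φ' y := by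
        intro y k hy hk
        have h1 := hd k y
        rcases (show 0 ≤ h y k by omega).eq_or_lt with h0 | h0
        · rw [hfix k y h0.symm]
        · rw [hne _ (by omega), hφ']
          simp only [hy, if_true]
          by_cases hkr : k = r y
          · rw [hkr]
          · refine hconf y k (r y) hkr h0 (hr y) φ fun z l h2 h3 => hφ z l ?_ ?_
            · push_cast; omega
            · push_cast; omega
      obtain ⟨c, hc⟩ := ih φ' fun y k hy hk => by
        by_cases h1 : d y = N₀ + n
        · exact heq y k h1 hk
        by_cases h2 : d (s k • y) = N₀ + n
        · have := heq (s k • y) k h2 (by rwa [hinv])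
          rw [hinv] at this
          exact this.symm
        · rw [hne _ h1, hne _ h2]
          exact hφ y k (by push_cast; omega) (by push_cast; omega)
      refine ⟨c, (hc.union (hfin (N₀ + n))).subset fun x hx => ?_⟩
      by_cases h1 : d x = N₀ + n
      · exact Or.inr h1.le
      · exact Or.inl (by
          change φ' x ≠ c
          rw [hne x h1]
          exact hx)
  -- The initial threshold lies above all of the finitely many points where some generator changes
  -- `φ`.
  obtain ⟨N, hN⟩ : ∃ N : ℕ, ∀ x i, φ (s i • x) ≠ φ x → d x < N₀ + N := by
    obtain ⟨B, hB⟩ := ((Set.finite_iUnion hφ).image d).bddAbove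
    refine ⟨(B - N₀ + 1).toNat, fun x i hx => ?_⟩
    have h1 : d x ≤ B := hB ⟨x, Set.mem_iUnion.2 ⟨i, hx⟩, rfl⟩
    omega
  exact key N φ fun y k hy _ => by
    by_contra hne
    exact absurd (hN y k hne) (by omega)

end Combinatorics

/-! ### Proper parabolic subgroups, and confluence in rank at least three -/

namespace AffineCartanMatrix

variable {I : Type} [Fintype I] [DecidableEq I] (C : AffineCartanMatrix I)

theorem subsingleton_H1_weightRingRep {J : Set I} (hJ : J ≠ Set.univ) :
    Subsingleton (groupCohomology.H1 (C.weightRingRep J)) := by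
  have := C.finite_parabolic hJ
  refine subsingleton_H1_of_forall_cocycle _ fun f hf => ?_
  replace hf : ∀ g k, f (g * k) = C.weightRingRepresentation J g (f k) + f g := hf
  have hF : IsFunctionCocycle fun (g : C.parabolic J) μ => (f g : WeightRing I).coeff μ := by
    intro g k μ
    simp only [hf g k, AddMonoidAlgebra.coeff_add, Finsupp.add_apply,
      weightRingRepresentation_coeff]
    ring
  obtain ⟨m, hm, hsupp⟩ := hF.exists_eq_of_finite
  have hfin : m.support.Finite :=
    (Set.finite_iUnion fun g => (f g : WeightRing I).coeff.hasFiniteSupport).subset fun μ hμ => by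
      obtain ⟨g, hg⟩ := hsupp μ hμ
      exact Set.mem_iUnion.2 ⟨g, hg⟩
  refine ⟨AddMonoidAlgebra.ofCoeff (Finsupp.ofSupportFinite m hfin), fun g => ?_⟩
  change f g = C.weightRingRepresentation J g _ - _
  refine AddMonoidAlgebra.ext (Finsupp.ext fun μ => ?_)
  rw [AddMonoidAlgebra.coeff_sub, Finsupp.sub_apply, weightRingRepresentation_coeff]
  exact hm g μ

/-- Cocycles with values in the orbit module as cocycles with values in functions. -/
theorem isFunctionCocycle_of_orbitRep (lam : WeightLattice I)
    (f : C.weylGroup → C.orbitRep lam)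
    (hf : ∀ g k, f (g * k) = (C.orbitRep lam).ρ g (f k) + f g) :
    IsFunctionCocycle fun (g : C.weylGroup) μ =>
      (f g : C.orbitSubmodule lam).1.coeff μ := by
  replace hf : ∀ g k, (f (g * k) : C.orbitSubmodule lam).1 =
      C.weightRingRepresentation Set.univ g (f k : C.orbitSubmodule lam).1 +
        (f g : C.orbitSubmodule lam).1 := fun g k => congrArg Subtype.val (hf g k)
  intro g k μ
  simp only [hf g k, AddMonoidAlgebra.coeff_add, Finsupp.add_apply,
      weightRingRepresentation_coeff]
  ring

/-- The element of the orbit module with given coefficients. -/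
def orbitElement (lam : WeightLattice I) (m : WeightLattice I → ℤ) (hfin : m.support.Finite)
    (horb : ∀ μ, m μ ≠ 0 → μ ∈ MulAction.orbit C.weylGroup lam) : C.orbitSubmodule lam :=
  ⟨AddMonoidAlgebra.ofCoeff (Finsupp.ofSupportFinite m hfin),
    (C.mem_orbitSubmodule_iff lam _).2 horb⟩

theorem eq_rho_orbitElement_sub (lam : WeightLattice I) {m : WeightLattice I → ℤ}
    (hfin : m.support.Finite) (horb : ∀ μ, m μ ≠ 0 → μ ∈ MulAction.orbit C.weylGroup lam)
    (g : C.weylGroup) (x : C.orbitSubmodule lam)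
    (h : ∀ μ, x.1.coeff μ = m (g⁻¹ • μ) - m μ) :
    x = (C.orbitRep lam).ρ g (C.orbitElement lam m hfin horb) -
      C.orbitElement lam m hfin horb := by
  refine Subtype.ext ?_
  change x.1 = C.weightRingRepresentation Set.univ g _ - _
  refine AddMonoidAlgebra.ext (Finsupp.ext fun μ => ?_)
  rw [AddMonoidAlgebra.coeff_sub, Finsupp.sub_apply, weightRingRepresentation_coeff]
  exact h μ

/-- The simple reflection as an element of the Weyl group. -/
def simpleReflection (i : I) : C.weylGroup :=
  ⟨C.reflection i, C.reflection_mem_parabolic (Set.mem_univ i)⟩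

theorem closure_range_simpleReflection :
    Subgroup.closure (Set.range C.simpleReflection) = ⊤ := by
  refine eq_top_iff.2 fun w _ => ?_
  have key : ∀ w (hw : w ∈ C.weylGroup), (⟨w, hw⟩ : C.weylGroup) ∈
      Subgroup.closure (Set.range C.simpleReflection) := by
    intro w hw
    induction hw using Subgroup.closure_induction with
    | mem x hx =>
      obtain ⟨i, -, rfl⟩ := hx
      exact Subgroup.subset_closure ⟨i, rfl⟩
    | one => exact Subgroup.one_mem _
    | mul x y _ _ hx hy => exact Subgroup.mul_mem _ hx hy
    | inv x _ hx => exact Subgroup.inv_mem _ hx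
  exact key w.1 w.2

theorem simpleReflection_smul (i : I) (μ : WeightLattice I) :
    C.simpleReflection i • μ = μ - C.coroot i μ • simpleRoot i := rfl

theorem simpleReflection_smul_smul (i : I) (μ : WeightLattice I) :
    C.simpleReflection i • C.simpleReflection i • μ = μ := C.reflection_reflection i μ

theorem simpleReflection_inv (i : I) : (C.simpleReflection i)⁻¹ = C.simpleReflection i :=
  inv_eq_of_mul_eq_one_left (Subtype.ext (LinearEquiv.ext fun μ => C.reflection_reflection i μ))

/-- The vector `2α_i - a_{ji} α_j` is orthogonal to `α_j` and has norm a positive multiple of `4 -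
a_{ij} a_{ji}`. A third vertex keeps it out of the radical, so the norm is positive. -/
theorem cartan_mul_lt_four (hI : 2 < Fintype.card I) {i j : I} (hij : i ≠ j) :
    C.A i j * C.A j i < 4 := by
  obtain ⟨k, hk⟩ : ∃ k, k ∉ ({i, j} : Finset I) := by
    by_contra! h
    have := Finset.card_le_card (fun x _ => h x : Finset.univ ⊆ ({i, j} : Finset I))
    rw [Finset.card_univ, Finset.card_pair hij] at this
    omega
  simp only [Finset.mem_insert, Finset.mem_singleton, not_or] at hk
  set q : I → ℤ := (2 : ℤ) • Pi.single i 1 - C.A j i • Pi.single j 1 with hq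
  have e : ((0, q) : WeightLattice I) = (2 : ℤ) • simpleRoot i - C.A j i • simpleRoot j := by
    ext <;> simp [simpleRoot, hq]
  have hpos := C.form_root_pos (q := q) (k := k) (fun h => by
    have := congrFun h i
    simp [hq, hij] at this) (by simp [hq, hk.1, hk.2])
  have hj : C.coroot j ((0, q) : WeightLattice I) = 0 := by
    rw [e, map_sub, map_zsmul, map_zsmul, coroot_simpleRoot, coroot_simpleRoot, C.diag]
    simp [mul_comm]
  have hi : C.coroot i ((0, q) : WeightLattice I) = 4 - C.A i j * C.A j i := by
    rw [e, map_sub, map_zsmul, map_zsmul, coroot_simpleRoot, coroot_simpleRoot, C.diag]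
    simp only [zsmul_eq_mul, Int.cast_id]
    ring
  have h1 : C.form ((0, q) : WeightLattice I) ((0, q) : WeightLattice I) =
      2 * ((C.comark i : ℚ) / C.mark i * (4 - C.A i j * C.A j i : ℤ)) := by
    conv_lhs => enter [1, 2]; rw [e]
    rw [map_sub, map_zsmul, map_zsmul, LinearMap.sub_apply, LinearMap.smul_apply,
      LinearMap.smul_apply, form_simpleRoot, form_simpleRoot, hi, hj]
    simp only [zsmul_eq_mul]
    push_cast
    ring
  rw [h1] at hpos
  have h2 : (0 : ℚ) < C.comark i := by exact_mod_cast C.comark_pos i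
  have h3 : (0 : ℚ) < C.mark i := by exact_mod_cast C.mark_pos i
  have h4 : (0 : ℚ) < (4 - C.A i j * C.A j i : ℤ) := by
    by_contra! h5
    have : (C.comark i : ℚ) / C.mark i * (4 - C.A i j * C.A j i : ℤ) ≤ 0 :=
      mul_nonpos_of_nonneg_of_nonpos (by positivity) h5
    linarith
  have h5 : 0 < 4 - C.A i j * C.A j i := by exact_mod_cast h4
  linarith

theorem height_sub_zsmul_simpleRoot (μ : WeightLattice I) (n : ℤ) (i : I) :
    height (μ - n • simpleRoot i).2 = height μ.2 - n := by
  have h : (μ - n • (simpleRoot i : WeightLattice I)).2 = μ.2 - n • Pi.single i 1 := by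
    ext; simp [simpleRoot]
  rw [h, map_sub, map_zsmul, height_apply (Pi.single i 1)]
  simp

/-- Every weight `x - εu α_i - εv α_j` lies `u + v` above `x` in depth, and the two reflections act
on `(u, v)` as in `rank_two_confluence`. -/
theorem orbit_confluent (hI : 2 < Fintype.card I) {lam : WeightLattice I} {ε : ℤ}
    (hε : ε * ε = 1) (x : MulAction.orbit C.weylGroup lam) {i j : I} (hij : i ≠ j)
    (hi : 0 < ε * C.coroot i x.1) (hj : 0 < ε * C.coroot j x.1)
    (φ : MulAction.orbit C.weylGroup lam → ℤ)
    (hφ : ∀ y k, -(ε * height x.1.2) < -(ε * height y.1.2) →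
      -(ε * height x.1.2) < -(ε * height (C.simpleReflection k • y).1.2) →
      φ (C.simpleReflection k • y) = φ y) :
    φ (C.simpleReflection i • x) = φ (C.simpleReflection j • x) := by
  classical
  set Y : ℤ → ℤ → WeightLattice I :=
    fun u v => x.1 - (ε * u) • simpleRoot i - (ε * v) • simpleRoot j with hY
  set p := ε * C.coroot i x.1 with hp
  set q := ε * C.coroot j x.1 with hq
  have hYh : ∀ u v, -(ε * height (Y u v).2) = -(ε * height x.1.2) + (u + v) := by
    intro u v
    rw [height_sub_zsmul_simpleRoot, height_sub_zsmul_simpleRoot]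
    linear_combination (u + v) * hε
  have hYi : ∀ u v, C.simpleReflection i • Y u v = Y (p - u + -C.A i j * v) v := by
    intro u v
    rw [simpleReflection_smul]
    simp only [hY, map_sub, map_zsmul, coroot_simpleRoot, C.diag, smul_eq_mul]
    rw [hp]
    have : ε * (ε * C.coroot i x.1 - u + -C.A i j * v) =
        C.coroot i x.1 - ε * u - ε * C.A i j * v := by linear_combination C.coroot i x.1 * hε
    rw [this]
    module
  have hYj : ∀ u v, C.simpleReflection j • Y u v = Y u (q - v + -C.A j i * u) := by
    intro u v
    rw [simpleReflection_smul]
    simp only [hY, map_sub, map_zsmul, coroot_simpleRoot, C.diag, smul_eq_mul]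
    rw [hq]
    have : ε * (ε * C.coroot j x.1 - v + -C.A j i * u) =
        C.coroot j x.1 - ε * v - ε * C.A j i * u := by linear_combination C.coroot j x.1 * hε
    rw [this]
    module
  -- Not every `(u, v)` gives a weight of the orbit. The value 0 elsewhere is harmless, because
  -- reflections preserve both the orbit and its complement.
  set ψ : ℤ → ℤ → ℤ := fun u v =>
    if h : Y u v ∈ MulAction.orbit C.weylGroup lam then φ ⟨Y u v, h⟩ else 0 with hψ
  have hstep : ∀ u v u' v' k, C.simpleReflection k • Y u v = Y u' v' → 0 < u + v → 0 < u' + v' →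
      ψ u' v' = ψ u v := by
    intro u v u' v' k hk h1 h2
    have h0 := hYh u v
    have h0' := hYh u' v'
    by_cases h : Y u v ∈ MulAction.orbit C.weylGroup lam
    · have h' : Y u' v' ∈ MulAction.orbit C.weylGroup lam :=
        hk ▸ MulAction.mem_orbit_of_mem_orbit _ h
      have e : (⟨Y u' v', h'⟩ : MulAction.orbit C.weylGroup lam) =
          C.simpleReflection k • ⟨Y u v, h⟩ := Subtype.ext hk.symm
      simp only [hψ, h, h', dif_pos]
      rw [e]
      refine hφ ⟨Y u v, h⟩ k ?_ ?_
      · change _ < -(ε * height (Y u v).2)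
        omega
      · change _ < -(ε * height (C.simpleReflection k • Y u v).2)
        rw [hk]
        omega
    · have h' : Y u' v' ∉ MulAction.orbit C.weylGroup lam := fun h' => h (by
        have := MulAction.mem_orbit_of_mem_orbit (C.simpleReflection k) h'
        rwa [← hk, simpleReflection_smul_smul] at this)
      simp only [hψ, h, h', dif_neg, not_false_eq_true]
  have h00 : Y 0 0 = x.1 := by simp [hY]
  have key := rank_two_confluence (a := -C.A i j) (b := -C.A j i) (p := p) (q := q)
    (by have := C.offDiag i j hij; omega) (by have := C.offDiag j i hij.symm; omega)
    (by
      have h1 := C.zero_symm i j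
      have h2 := C.zero_symm j i
      omega)
    (by have := C.cartan_mul_lt_four hI hij; linarith) hi hj ψ
    (fun u v u' hu h1 h2 => hstep u v u' v i (by rw [hYi, hu]) h1 h2)
    (fun u v v' hv h1 h2 => hstep u v u v' j (by rw [hYj, hv]) h1 h2)
  have hi' : Y p 0 = (C.simpleReflection i • x).1 := by
    have := hYi 0 0
    rw [h00] at this
    simp only [sub_zero, mul_zero, add_zero] at this
    exact this.symm
  have hj' : Y 0 q = (C.simpleReflection j • x).1 := by
    have := hYj 0 0
    rw [h00] at this
    simp only [sub_zero, mul_zero, add_zero] at this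
    exact this.symm
  simpa only [hψ, hi', hj', Subtype.coe_prop, dif_pos, Subtype.coe_eta] using key

end AffineCartanMatrix

/-! ### Vanishing for nonzero level -/

namespace AffineCartanMatrix

variable {I : Type} [Fintype I] [DecidableEq I] (C : AffineCartanMatrix I)

theorem smul_mem_iff_of_forall_simpleReflection {T : Set (WeightLattice I)}
    (hT : ∀ i, ∀ μ ∈ T, C.simpleReflection i • μ ∈ T) (g : C.weylGroup) (μ : WeightLattice I) :
    g • μ ∈ T ↔ μ ∈ T := by
  have hg : g ∈ Subgroup.closure (Set.range C.simpleReflection) :=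
    C.closure_range_simpleReflection ▸ Subgroup.mem_top g
  induction hg using Subgroup.closure_induction generalizing μ with
  | mem x hx =>
    obtain ⟨i, rfl⟩ := hx
    refine ⟨fun h => ?_, hT i μ⟩
    have := hT i _ h
    rwa [simpleReflection_smul_smul] at this
  | one => simp
  | mul a b _ _ ha hb => rw [mul_smul]; exact (ha _).trans (hb _)
  | inv a _ ha => exact (ha _).symm.trans (by rw [smul_inv_smul])

theorem level_smul (g : C.weylGroup) (μ : WeightLattice I) : C.level (g • μ) = C.level μ :=
  C.level_apply g.2 μ

theorem coroot_simpleReflection_smul (i : I) (μ : WeightLattice I) :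
    C.coroot i (C.simpleReflection i • μ) = -C.coroot i μ := by
  rw [simpleReflection_smul, map_sub, map_zsmul, coroot_simpleRoot, C.diag, smul_eq_mul]
  ring

/-- An imaginary root pairs with `λ` to a nonzero multiple of the level, so the orthogonal root is
real, `w α_i`; move it to `α_i` by `w⁻¹`. -/
theorem exists_coroot_eq_zero_of_not_isRegular {lam : WeightLattice I} (hlam : C.level lam ≠ 0)
    (hreg : ¬ C.IsRegular lam) :
    ∃ x₀ ∈ MulAction.orbit C.weylGroup lam, ∃ i, C.coroot i x₀ = 0 := by
  simp only [IsRegular, not_forall, not_not] at hreg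
  obtain ⟨β, hβ, h0⟩ := hreg
  rcases hβ with ⟨w, hw, i, rfl⟩ | ⟨n, hn, rfl⟩
  · refine ⟨(⟨w, hw⟩ : C.weylGroup)⁻¹ • lam, MulAction.mem_orbit _ _, i, ?_⟩
    have h1 := C.form_apply_apply hw (simpleRoot i) ((⟨w, hw⟩ : C.weylGroup)⁻¹ • lam)
    have h2 : w ((⟨w, hw⟩ : C.weylGroup)⁻¹ • lam) = lam := w.apply_symm_apply lam
    rw [h2, h0, form_simpleRoot] at h1
    have h3 : (C.comark i : ℚ) ≠ 0 := by exact_mod_cast (C.comark_pos i).ne'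
    have h4 : (C.mark i : ℚ) ≠ 0 := by exact_mod_cast (C.mark_pos i).ne'
    exact_mod_cast (mul_eq_zero.1 h1.symm).resolve_left (div_ne_zero h3 h4)
  · rw [map_zsmul, LinearMap.smul_apply, form_delta, zsmul_eq_mul] at h0
    have h1 : (n : ℚ) ≠ 0 := by exact_mod_cast hn
    have h2 : (C.level lam : ℚ) ≠ 0 := by exact_mod_cast hlam
    exact absurd h0 (mul_ne_zero h1 h2)

/-- In rank two, the orbit of a weight which is not regular contains no weight in the interior of
the dominant chamber. -/
theorem not_coroot_pos_of_not_isRegular (hI : Fintype.card I ≤ 2) {lam : WeightLattice I} {ε : ℤ}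
    (hε : 0 < ε * C.level lam) (hreg : ¬ C.IsRegular lam) {x : WeightLattice I}
    (hx : x ∈ MulAction.orbit C.weylGroup lam) {i j : I} (hij : i ≠ j)
    (hi : 0 < ε * C.coroot i x) (hj : 0 < ε * C.coroot j x) : False := by
  have hall : ∀ k, k = i ∨ k = j := by
    have : ({i, j} : Finset I) = Finset.univ := by
      apply Finset.eq_univ_of_card
      have := Finset.card_le_univ ({i, j} : Finset I)
      rw [Finset.card_pair hij] at this ⊢
      omega
    intro k
    have hk := Finset.mem_univ k
    rw [← this] at hk
    simpa using hk
  have hlam : C.level lam ≠ 0 := by rintro h; simp [h] at hε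
  obtain ⟨x₀, hx₀, l, hl⟩ := C.exists_coroot_eq_zero_of_not_isRegular hlam hreg
  obtain ⟨l', hl', hll'⟩ : ∃ l', l' ≠ l ∧ ∀ k, k = l ∨ k = l' := by
    rcases hall l with rfl | rfl
    · exact ⟨j, hij.symm, hall⟩
    · exact ⟨i, hij, fun k => (hall k).symm⟩
  -- Start at a weight fixed by `s_l` and reflect alternately in `l'`, `l`, `l'`, …. The first
  -- reflection must be `l'`; since `s_l` fixes the start, the sequence `z` exhausts the orbit.
  set c : ℕ → I := fun n => if Even n then l' else l with hc
  set z : ℕ → WeightLattice I := fun n => Nat.rec x₀ (fun n y => C.simpleReflection (c n) • y) n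
    with hz
  have hzs : ∀ n, z (n + 1) = C.simpleReflection (c n) • z n := fun n => rfl
  have hc2 : ∀ n k, k = c n ∨ k = c (n + 1) := by
    intro n k
    by_cases h : Even n <;> simp only [hc, Nat.even_add_one, h, not_true, not_false_eq_true,
      if_true, if_false]
    · exact (hll' k).symm
    · exact hll' k
  have horb : ∀ n, z n ∈ MulAction.orbit C.weylGroup lam := by
    intro n
    induction n with
    | zero => exact hx₀
    | succ n ih => exact MulAction.mem_orbit_of_mem_orbit _ ih
  have hclosed : ∀ k, ∀ μ ∈ Set.range z, C.simpleReflection k • μ ∈ Set.range z := by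
    rintro k _ ⟨n, rfl⟩
    rcases n with - | n
    · rcases hll' k with rfl | rfl
      · refine ⟨0, ?_⟩
        change x₀ = C.simpleReflection k • x₀
        rw [simpleReflection_smul, hl, zero_smul, sub_zero]
      · exact ⟨1, by simp [hzs, hc]⟩
    · rcases hc2 n k with rfl | rfl
      · exact ⟨n, by rw [hzs, simpleReflection_smul_smul]⟩
      · exact ⟨n + 2, rfl⟩
  have hlev : ∀ n, 0 < ε * C.level (z n) := by
    intro n
    obtain ⟨g, hg⟩ := horb n
    have hg' : g • lam = z n := hg
    rwa [← hg', level_smul]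
  -- At `z n` the coroot other than `c n` is nonpositive up to the sign `ε`. As the level is
  -- positive up to that sign, the coroot `c n` is positive, and reflecting makes it negative at `z
  -- (n + 1)`.
  have hsign : ∀ n, ∃ k, (∀ k', k' = c n ∨ k' = k) ∧ k ≠ c n ∧ ε * C.coroot k (z n) ≤ 0 := by
    intro n
    induction n with
    | zero =>
      refine ⟨l, fun k => by simpa [hc] using (hll' k).symm, by simpa [hc] using hl'.symm, ?_⟩
      change ε * C.coroot l x₀ ≤ 0
      simp [hl]
    | succ n ih =>
      obtain ⟨k, hk, hkc, hkn⟩ := ih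
      obtain ⟨k₁, hk₁⟩ := C.exists_coroot_pos (hlev n)
      have hk₁c : k₁ = c n := (hk k₁).resolve_right fun h => by
        rw [h] at hk₁
        omega
      refine ⟨c n, fun k' => (hc2 n k').symm, ?_, ?_⟩
      · by_cases h : Even n <;> simp [hc, Nat.even_add_one, h, hl', hl'.symm]
      · rw [hzs, coroot_simpleReflection_smul, ← hk₁c]
        linarith
  have hxz : x ∈ Set.range z := by
    obtain ⟨g, rfl⟩ := hx
    obtain ⟨g', hg'⟩ := hx₀
    have hg'' : g' • lam = x₀ := hg'
    have h0 : x₀ ∈ Set.range z := ⟨0, rfl⟩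
    rw [← hg'', C.smul_mem_iff_of_forall_simpleReflection hclosed] at h0
    exact (C.smul_mem_iff_of_forall_simpleReflection hclosed g lam).2 h0
  obtain ⟨n, rfl⟩ := hxz
  obtain ⟨k, -, -, hk⟩ := hsign n
  rcases hall k with rfl | rfl <;> omega

theorem subsingleton_H1_orbitRep {lam : WeightLattice I} (hlam : C.level lam ≠ 0)
    (h : ¬ C.IsRegular lam ∨ 2 < Fintype.card I) :
    Subsingleton (groupCohomology.H1 (C.orbitRep lam)) := by
  classical
  obtain ⟨ε, hεε, hε⟩ : ∃ ε : ℤ, ε * ε = 1 ∧ 0 < ε * C.level lam := by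
    rcases lt_or_gt_of_ne hlam with h | h
    · exact ⟨-1, by norm_num, by omega⟩
    · exact ⟨1, by norm_num, by omega⟩
  refine subsingleton_H1_of_forall_cocycle _ fun f hf => ?_
  have hF := C.isFunctionCocycle_of_orbitRep lam f hf
  set F : C.weylGroup → WeightLattice I → ℤ :=
    fun g μ => (f g : C.orbitSubmodule lam).1.coeff μ with hFdef
  set X := MulAction.orbit C.weylGroup lam with hX
  set x₀ : X := ⟨lam, MulAction.mem_orbit_self lam⟩ with hx₀
  have htrans : ∀ x : X, ∃ g : C.weylGroup, x = g • x₀ := by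
    rintro ⟨_, g, rfl⟩
    exact ⟨g, rfl⟩
  have hF' : IsFunctionCocycle fun (g : C.weylGroup) (x : X) => F g x.1 := fun g k x => hF g k x.1
  have hstab : Finite (MulAction.stabilizer C.weylGroup x₀) := by
    have := C.finite_stabilizer hlam
    have e : MulAction.stabilizer C.weylGroup x₀ = MulAction.stabilizer C.weylGroup lam := by
      ext g
      exact Subtype.ext_iff
    rwa [e]
  obtain ⟨φ, hφ⟩ := hF'.exists_eq_of_finite_stabilizer x₀ htrans
  have hpos : ∀ x : X, 0 < ε * C.level x.1 := by
    rintro ⟨_, g, rfl⟩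
    change 0 < ε * C.level (g • lam)
    rwa [level_smul]
  obtain ⟨c, hc⟩ := exists_finite_setOf_ne_of_confluent C.simpleReflection
    C.closure_range_simpleReflection x₀ htrans
    (fun i x => Subtype.ext (C.simpleReflection_smul_smul i x.1))
    (fun x => -(ε * height x.1.2)) (fun x i => ε * C.coroot i x.1)
    (fun i x => by
      have h1 := height_sub_zsmul_simpleRoot x.1 (C.coroot i x.1) i
      change -(ε * height (x.1 - C.coroot i x.1 • simpleRoot i).2) = _
      rw [h1]
      ring)
    (fun i x hx => Subtype.ext (by
      have h1 : C.coroot i x.1 = 0 := (mul_eq_zero.1 hx).resolve_left (by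
        rintro rfl
        simp at hεε)
      change x.1 - C.coroot i x.1 • simpleRoot i = x.1
      rw [h1, zero_smul, sub_zero]))
    (fun N => by
      refine ((C.finite_setOf_depth_le hε N).preimage
        (f := (Subtype.val : X → WeightLattice I)) Subtype.val_injective.injOn).subset ?_
      exact fun x hx => ⟨x.2, hx⟩)
    (fun x => C.exists_coroot_pos (hpos x))
    (fun x i j hij hi hj ψ hψ => by
      by_cases hI : 2 < Fintype.card I
      · exact C.orbit_confluent hI hεε x hij hi hj ψ hψ
      · exact (C.not_coroot_pos_of_not_isRegular (not_lt.1 hI) hε (h.resolve_right hI) x.2 hij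
          hi hj).elim)
    φ (fun i => by
      refine (((f (C.simpleReflection i) : C.orbitSubmodule lam).1.coeff.hasFiniteSupport).preimage
        (f := (Subtype.val : X → WeightLattice I)) Subtype.val_injective.injOn).subset ?_
      intro x hx
      have h1 := hφ (C.simpleReflection i) x
      rw [simpleReflection_inv] at h1
      change F (C.simpleReflection i) x.1 ≠ 0
      rw [h1]
      exact sub_ne_zero.2 hx)
  -- Subtracting the constant `c` leaves the coboundary unchanged and makes the support finite.
  set m : WeightLattice I → ℤ := fun μ => if hμ : μ ∈ X then φ ⟨μ, hμ⟩ - c else 0 with hm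
  have hfin : m.support.Finite := by
    refine (hc.image Subtype.val).subset fun μ hμ => ?_
    by_cases hμX : μ ∈ X
    · refine ⟨⟨μ, hμX⟩, fun h0 => hμ ?_, rfl⟩
      simp only [hm, hμX, dif_pos]
      rw [h0, sub_self]
    · exact absurd (dif_neg hμX) hμ
  have horb : ∀ μ, m μ ≠ 0 → μ ∈ MulAction.orbit C.weylGroup lam := fun μ hμ => by
    by_contra hμX
    exact hμ (dif_neg hμX)
  refine ⟨C.orbitElement lam m hfin horb, fun g => C.eq_rho_orbitElement_sub lam hfin horb g _
    fun μ => ?_⟩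
  by_cases hμ : μ ∈ X
  · have hgμ : g⁻¹ • μ ∈ X := MulAction.mem_orbit_of_mem_orbit _ hμ
    simp only [hm, hμ, hgμ, dif_pos]
    rw [sub_sub_sub_cancel_right]
    exact hφ g ⟨μ, hμ⟩
  · have hgμ : g⁻¹ • μ ∉ X := fun h => hμ (by
      have := MulAction.mem_orbit_of_mem_orbit g h
      rwa [smul_inv_smul] at this)
    simp only [hm, hμ, hgμ, dif_neg, not_false_eq_true, sub_zero]
    by_contra h0
    exact hμ ((C.mem_orbitSubmodule_iff lam _).1 (f g : C.orbitSubmodule lam).2 μ h0)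

end AffineCartanMatrix

/-! ### Level zero: shifts along `δ` and the finite Weyl group -/

namespace AffineCartanMatrix

section

variable {I : Type} [Fintype I] (C : AffineCartanMatrix I)

theorem level_delta : C.level C.delta = 0 := by
  simp [level, coroot_delta]

theorem coroot_add_zsmul_delta (i : I) (μ : WeightLattice I) (n : ℤ) :
    C.coroot i (μ + n • C.delta) = C.coroot i μ := by
  rw [map_add, map_zsmul, coroot_delta, smul_zero, add_zero]

theorem coroot_sub_zsmul_delta (i : I) (μ : WeightLattice I) (n : ℤ) :
    C.coroot i (μ - n • C.delta) = C.coroot i μ := by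
  rw [map_sub, map_zsmul, coroot_delta, smul_zero, sub_zero]

theorem level_add_zsmul_delta (μ : WeightLattice I) (n : ℤ) :
    C.level (μ + n • C.delta) = C.level μ := by
  rw [map_add, map_zsmul, level_delta, smul_zero, add_zero]

theorem level_sub_zsmul_delta (μ : WeightLattice I) (n : ℤ) :
    C.level (μ - n • C.delta) = C.level μ := by
  rw [map_sub, map_zsmul, level_delta, smul_zero, sub_zero]

end

variable {I : Type} [Fintype I] [DecidableEq I] (C : AffineCartanMatrix I)

theorem smul_add_zsmul_delta (g : C.weylGroup) (μ : WeightLattice I) (n : ℤ) :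
    g • (μ + n • C.delta) = g • μ + n • C.delta := by
  change g.1 (μ + n • C.delta) = g.1 μ + n • C.delta
  rw [map_add, map_zsmul, C.apply_delta g.2]

theorem smul_sub_zsmul_delta (g : C.weylGroup) (μ : WeightLattice I) (n : ℤ) :
    g • (μ - n • C.delta) = g • μ - n • C.delta := by
  have := C.smul_add_zsmul_delta g μ (-n)
  simpa only [neg_smul, ← sub_eq_add_neg] using this

/-- An element of `Q` orthogonal to `Q` is a multiple of `δ`. -/
theorem exists_eq_zsmul_mark {q : I → ℤ}
    (h : ∀ r : I → ℤ, C.form ((0, r) : WeightLattice I) ((0, q) : WeightLattice I) = 0) :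
    ∃ n : ℤ, q = n • C.mark := by
  refine (C.mark_spec.2 q).1 (funext fun i => ?_)
  have h1 := h (Pi.single i 1)
  have h2 := C.form_simpleRoot i ((0, q) : WeightLattice I)
  rw [simpleRoot, h1] at h2
  have h3 : (C.comark i : ℚ) ≠ 0 := by exact_mod_cast (C.comark_pos i).ne'
  have h4 : (C.mark i : ℚ) ≠ 0 := by exact_mod_cast (C.mark_pos i).ne'
  have h5 : C.coroot i ((0, q) : WeightLattice I) = 0 := by
    exact_mod_cast (mul_eq_zero.1 h2.symm).resolve_left (div_ne_zero h3 h4)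
  simpa [coroot_apply] using h5

/-- The Weyl group acts faithfully on `Q`. -/
theorem eq_of_forall_smul_root_eq {g k : C.weylGroup}
    (h : ∀ q : I → ℤ, g • ((0, q) : WeightLattice I) = k • ((0, q) : WeightLattice I)) :
    g = k := by
  set w := g⁻¹ * k with hw
  have hQ : ∀ q : I → ℤ, w • ((0, q) : WeightLattice I) = ((0, q) : WeightLattice I) := fun q => by
    rw [hw, mul_smul, ← h, inv_smul_smul]
  -- Since `w` fixes `Q`, the displacement `wμ - μ` is orthogonal to `Q`, hence equal to `nδ`;
  -- preservation of `(μ, μ)` then gives `2n ⟨c, μ⟩ = 0`.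
  have hlev : ∀ μ : WeightLattice I, C.level μ ≠ 0 → w • μ = μ := by
    intro μ hμ
    obtain ⟨q, hq, -⟩ := C.exists_apply_eq_add w.2 μ
    obtain ⟨n, rfl⟩ := C.exists_eq_zsmul_mark (q := q) fun r => by
      have h1 := C.form_apply_apply w.2 ((0, r) : WeightLattice I) μ
      have h2 : w.1 ((0, r) : WeightLattice I) = (0, r) := hQ r
      rw [h2, hq, map_add] at h1
      linarith
    have h3 := C.form_add_two_pairing_eq_zero w.2 hq
    have h4 : ((0, n • C.mark) : WeightLattice I) = n • C.delta := by ext <;> simp [delta]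
    have h5 : C.form C.delta C.delta = 0 := C.form_root_delta C.mark
    rw [map_zsmul, pairing_mark, h4, map_zsmul, map_zsmul, LinearMap.smul_apply, h5] at h3
    simp only [smul_zero, zero_add, zsmul_eq_mul] at h3
    have h6 : (C.level μ : ℚ) ≠ 0 := by exact_mod_cast hμ
    have h7 : n = 0 := by
      have : (n : ℚ) = 0 := by
        rcases mul_eq_zero.1 h3 with h | h
        · norm_num at h
        · exact (mul_eq_zero.1 h).resolve_right h6
      exact_mod_cast this
    change w.1 μ = μ
    rw [hq, h7, zero_smul]
    exact add_zero μ
  have hall : ∀ μ : WeightLattice I, w • μ = μ := by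
    intro μ
    by_cases hμ : C.level μ = 0
    · obtain ⟨i⟩ := C.nonempty
      -- A weight of level zero is the difference of `μ + Λ_i` and `Λ_i`, both of nonzero level.
      set Λ : WeightLattice I := (Pi.single i 1, 0) with hΛ
      have h1 : C.level Λ = C.comark i := by
        simp [level, hΛ, coroot_fundamental]
      have h2 := hlev Λ (by rw [h1]; exact (C.comark_pos i).ne')
      have h3 := hlev (μ + Λ) (by rw [map_add, hμ, h1, zero_add]; exact (C.comark_pos i).ne')
      rw [smul_add, h2] at h3
      exact add_right_cancel h3
    · exact hlev μ hμ
  have h1 : w = 1 := Subtype.ext (LinearEquiv.ext hall)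
  exact inv_mul_eq_one.1 h1

/-- The finite Weyl group attached to the vertex `o`, inside the Weyl group. -/
def finiteWeylGroup (o : I) : Subgroup C.weylGroup :=
  (C.parabolic {o}ᶜ).subgroupOf C.weylGroup

theorem finite_finiteWeylGroup (o : I) : Finite (C.finiteWeylGroup o) := by
  have : Finite (C.parabolic {o}ᶜ) := C.finite_parabolic (by simp)
  exact Finite.of_equiv _
    (Subgroup.subgroupOfEquivOfLe (C.parabolic_le_weylGroup {o}ᶜ)).symm.toEquiv

theorem simpleReflection_mem_finiteWeylGroup {o i : I} (hi : i ≠ o) :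
    C.simpleReflection i ∈ C.finiteWeylGroup o :=
  Subgroup.mem_subgroupOf.2 (C.reflection_mem_parabolic (J := {o}ᶜ) hi)

theorem exists_smul_eq_add_of_mem_finiteWeylGroup {o : I} {v : C.weylGroup}
    (hv : v ∈ C.finiteWeylGroup o) (μ : WeightLattice I) :
    ∃ q : I → ℤ, v • μ = μ + ((0, q) : WeightLattice I) ∧ q o = 0 := by
  obtain ⟨q, hq, hq'⟩ := C.exists_apply_eq_add (Subgroup.mem_subgroupOf.1 hv) μ
  exact ⟨q, hq, hq' o (by simp)⟩

/-- On weights of level zero, `s_o` is an element of the finite Weyl group (the reflection in the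
root `δ - α_o`), followed by a translation along `δ`. -/
theorem IsZeroVertex.exists_smul_eq {o : I} (ho : C.IsZeroVertex o) :
    ∃ v ∈ C.finiteWeylGroup o, ∀ μ : WeightLattice I, C.level μ = 0 →
      C.simpleReflection o • μ = v • μ - C.coroot o μ • C.delta := by
  obtain ⟨w, hw, hwq⟩ := ho.2 _ (C.simpleReflection o).2
  set v : C.weylGroup := ⟨w, C.parabolic_le_weylGroup _ hw⟩ with hv
  have hvmem : v ∈ C.finiteWeylGroup o := Subgroup.mem_subgroupOf.2 hw
  refine ⟨v, hvmem, fun μ hμ => ?_⟩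
  obtain ⟨q, hq, hqo⟩ := C.exists_smul_eq_add_of_mem_finiteWeylGroup hvmem μ
  set x : I → ℤ := -(C.coroot o μ • Pi.single o 1) - q with hx
  have hxe : C.simpleReflection o • μ = v • μ + ((0, x) : WeightLattice I) := by
    rw [hq, simpleReflection_smul, simpleRoot]
    ext <;> simp [hx]
    abel
  -- The elements `s_o` and `v` agree on `Q` modulo `δ`, and `δ` is orthogonal to weights of level
  -- zero; so `s_o μ` and `v μ` have the same products with `Q`.
  obtain ⟨n, hn⟩ := C.exists_eq_zsmul_mark (q := x) fun r => by
    obtain ⟨r', hr'⟩ : ∃ r' : I → ℤ,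
        C.simpleReflection o • ((0, r) : WeightLattice I) = (0, r') := by
      obtain ⟨y, hy, -⟩ := C.exists_apply_eq_add (C.simpleReflection o).2 ((0, r) : WeightLattice I)
      exact ⟨r + y, hy.trans (by ext <;> simp)⟩
    have hr : C.simpleReflection o • ((0, r') : WeightLattice I) = (0, r) := by
      rw [← hr', simpleReflection_smul_smul]
    obtain ⟨k, hk⟩ := hwq r'
    have hk' : ((0, r) : WeightLattice I) = v • ((0, r') : WeightLattice I) + k • C.delta := by
      rw [← hr]
      exact (sub_eq_iff_eq_add'.1 hk)
    have h1 : C.form ((0, r) : WeightLattice I) (C.simpleReflection o • μ) =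
        C.form ((0, r') : WeightLattice I) μ := by
      rw [← hr]
      exact C.form_apply_apply (C.simpleReflection o).2 _ _
    have h2 : C.form ((0, r) : WeightLattice I) (v • μ) = C.form ((0, r') : WeightLattice I) μ := by
      have h3 : C.form (v • ((0, r') : WeightLattice I)) (v • μ) =
        C.form ((0, r') : WeightLattice I) μ := C.form_apply_apply v.2 _ _
      rw [hk', map_add, LinearMap.add_apply, h3, map_zsmul, LinearMap.smul_apply, form_delta,
        level_smul, hμ]
      simp
    rw [hxe, map_add, h2] at h1
    linarith
  -- Compare `α_o`-coordinates: `v` does not change that of `μ`, and `δ` has coordinate 1 there.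
  have hno : n = -C.coroot o μ := by
    have h1 := congrFun hn o
    simp [hx, hqo, ho.1] at h1
    exact h1.symm
  have hd : ((0, n • C.mark) : WeightLattice I) = n • C.delta := by ext <;> simp [delta]
  rw [hxe, hn, hd, hno, neg_smul, ← sub_eq_add_neg]

/-- Since `W` fixes `δ`, one shifted weight in the orbit makes the whole orbit stable under the
shift. -/
theorem mul_oneSubExp_mem_orbitSubmodule {lam : WeightLattice I} {n : ℤ}
    (h : lam + n • C.delta ∈ MulAction.orbit C.weylGroup lam) :
    (∀ μ, μ - n • C.delta ∈ MulAction.orbit C.weylGroup lam →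
      μ ∈ MulAction.orbit C.weylGroup lam) ∧
    ∀ x ∈ C.orbitSubmodule lam, C.oneSubExp n * x ∈ C.orbitSubmodule lam := by
  have key : ∀ μ, μ - n • C.delta ∈ MulAction.orbit C.weylGroup lam →
      μ ∈ MulAction.orbit C.weylGroup lam := by
    rintro μ ⟨g, hg⟩
    have hg' : g • lam = μ - n • C.delta := hg
    have : μ = g • (lam + n • C.delta) := by rw [smul_add_zsmul_delta, hg', sub_add_cancel]
    rw [this]
    exact MulAction.mem_orbit_of_mem_orbit g h
  refine ⟨key, fun x hx => ?_⟩
  rw [mem_orbitSubmodule_iff] at hx ⊢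
  intro μ hμ
  rw [oneSubExp_mul_coeff] at hμ
  by_cases h0 : x.coeff μ = 0
  · exact key μ (hx _ fun h1 => hμ (by rw [h0, h1, sub_zero]))
  · exact hx μ h0

end AffineCartanMatrix

/-! ### Level zero: annihilation by `1 - e^{nδ}` -/

namespace AffineCartanMatrix

variable {I : Type} [Fintype I] [DecidableEq I] (C : AffineCartanMatrix I)

/-- The relation imposed on a cocycle vanishing on the finite Weyl group by the commutativity of
the group of translations. -/
theorem add_eq_add_of_vanishing_on_finiteWeylGroup {o : I} {F : C.weylGroup → WeightLattice I → ℤ}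
    (hF : IsFunctionCocycle F) (hvan : ∀ v ∈ C.finiteWeylGroup o, ∀ μ, F v μ = 0)
    {w : C.weylGroup} (hw : w ∈ C.finiteWeylGroup o)
    (hsw : ∀ μ : WeightLattice I, C.level μ = 0 →
      C.simpleReflection o • μ = w • μ - C.coroot o μ • C.delta)
    {v : C.weylGroup} (hv : v ∈ C.finiteWeylGroup o) {μ : WeightLattice I} (hμ : C.level μ = 0) :
    F (C.simpleReflection o) μ + F (C.simpleReflection o) (v⁻¹ • μ - C.coroot o μ • C.delta) =
      F (C.simpleReflection o) (v⁻¹ • μ) +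
        F (C.simpleReflection o) (μ - C.coroot o (v⁻¹ • μ) • C.delta) := by
  set s := C.simpleReflection o with hs
  set τ := s * w⁻¹ with hτ
  set H := C.finiteWeylGroup o with hH
  have hcw : ∀ μ, C.level μ = 0 → C.coroot o (w⁻¹ • μ) = -C.coroot o μ := by
    intro μ hμ
    have h1 := hsw (w⁻¹ • μ) (by rwa [level_smul])
    have h2 := congrArg (C.coroot o) h1
    rw [hs, coroot_simpleReflection_smul, coroot_sub_zsmul_delta, smul_inv_smul] at h2
    omega
  have hτμ : ∀ μ, C.level μ = 0 → τ • μ = μ + C.coroot o μ • C.delta := by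
    intro μ hμ
    rw [hτ, mul_smul, hsw _ (by rwa [level_smul]), smul_inv_smul, hcw μ hμ, neg_smul,
      sub_neg_eq_add]
  have hτi : ∀ μ, C.level μ = 0 → τ⁻¹ • μ = μ - C.coroot o μ • C.delta := by
    intro μ hμ
    rw [inv_smul_eq_iff, hτμ _ (by rwa [level_sub_zsmul_delta]), coroot_sub_zsmul_delta,
      sub_add_cancel]
  have hτv : ∀ μ, C.level μ = 0 →
      (v * τ * v⁻¹) • μ = μ + C.coroot o (v⁻¹ • μ) • C.delta := by
    intro μ hμ
    rw [mul_smul, mul_smul, hτμ _ (by rwa [level_smul]), smul_add_zsmul_delta, smul_inv_smul]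
  have hτvi : ∀ μ, C.level μ = 0 →
      (v * τ * v⁻¹)⁻¹ • μ = μ - C.coroot o (v⁻¹ • μ) • C.delta := by
    intro μ hμ
    rw [inv_smul_eq_iff, hτv _ (by rwa [level_sub_zsmul_delta]), smul_sub_zsmul_delta,
      coroot_sub_zsmul_delta, sub_add_cancel]
  -- On `Q` both elements are shifts along `δ` by amounts insensitive to `δ`, so they commute there;
  -- faithfulness on `Q` gives commutation in `W`.
  have hcomm : τ * (v * τ * v⁻¹) = (v * τ * v⁻¹) * τ := by
    refine C.eq_of_forall_smul_root_eq fun q => ?_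
    have hq : C.level ((0, q) : WeightLattice I) = 0 := by
      have h1 := C.form_delta ((0, q) : WeightLattice I)
      rw [form_comm, form_root_delta] at h1
      exact_mod_cast h1.symm
    rw [mul_smul τ, mul_smul _ τ, hτv _ hq, hτμ _ hq, hτμ _ (by rwa [level_add_zsmul_delta]),
      hτv _ (by rwa [level_add_zsmul_delta]), smul_add_zsmul_delta, coroot_add_zsmul_delta,
      coroot_add_zsmul_delta, add_right_comm]
  have hFτ : ∀ μ, F τ μ = F s μ := fun μ => by
    rw [hτ, hF, hvan _ (H.inv_mem hw), add_zero]
  have hFτv : ∀ μ, F (v * τ * v⁻¹) μ = F s (v⁻¹ • μ) := fun μ => by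
    rw [mul_assoc, hF, hF, hvan v hv, hvan _ (H.inv_mem hv), hFτ, zero_add, add_zero]
  -- Expanding the cocycle on the two orders of the commuting product gives the relation.
  have h1 := hF τ (v * τ * v⁻¹) μ
  rw [hcomm, hF, hFτ, hFτ, hFτv, hFτv, hτi μ hμ, hτvi μ hμ, smul_sub_zsmul_delta] at h1
  exact h1.symm

/-- The orbit of a weight of level zero, up to translations along `δ`, is an orbit of the finite
Weyl group. -/
theorem IsZeroVertex.exists_inv_smul_eq {o : I} (ho : C.IsZeroVertex o) {lam : WeightLattice I}
    (hlam : C.level lam = 0) : ∀ μ ∈ MulAction.orbit C.weylGroup lam,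
      ∃ v ∈ C.finiteWeylGroup o, ∃ j : ℤ, v⁻¹ • μ = lam + j • C.delta := by
  obtain ⟨w, hw, hsw⟩ := ho.exists_smul_eq
  set H := C.finiteWeylGroup o with hH
  set T : Set (WeightLattice I) := {μ | ∃ v ∈ H, ∃ j : ℤ, μ = v • lam + j • C.delta} with hT
  have hclosed : ∀ i, ∀ μ ∈ T, C.simpleReflection i • μ ∈ T := by
    rintro i _ ⟨v, hv, j, rfl⟩
    by_cases hi : i = o
    · subst hi
      refine ⟨w * v, H.mul_mem hw hv, j - C.coroot i (v • lam + j • C.delta), ?_⟩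
      rw [hsw _ (by rwa [level_add_zsmul_delta, level_smul]), smul_add_zsmul_delta, mul_smul,
        sub_smul, add_sub_assoc]
    · exact ⟨C.simpleReflection i * v,
        H.mul_mem (C.simpleReflection_mem_finiteWeylGroup hi) hv, j, by
        rw [smul_add_zsmul_delta, mul_smul]⟩
  rintro _ ⟨g, rfl⟩
  have h1 : g • lam ∈ T := (C.smul_mem_iff_of_forall_simpleReflection hclosed g lam).2
    ⟨1, H.one_mem, 0, by simp⟩
  obtain ⟨v, hv, j, h2⟩ := h1
  refine ⟨v, hv, j, ?_⟩
  change v⁻¹ • g • lam = _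
  rw [h2, smul_add_zsmul_delta, inv_smul_smul]
/-- The orbit of a weight of level zero is stable under the translation by `⟨h_o, λ⟩ δ`. -/
theorem IsZeroVertex.add_mem_orbit {o : I} (ho : C.IsZeroVertex o) {lam : WeightLattice I}
    (hlam : C.level lam = 0) :
    lam + C.coroot o lam • C.delta ∈ MulAction.orbit C.weylGroup lam := by
  obtain ⟨w, -, hsw⟩ := ho.exists_smul_eq
  refine ⟨(C.simpleReflection o)⁻¹ * w, ?_⟩
  change ((C.simpleReflection o)⁻¹ * w) • lam = _
  rw [mul_smul, inv_smul_eq_iff, smul_add_zsmul_delta, hsw lam hlam, sub_add_cancel]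

/-- A cocycle which vanishes on the finite Weyl group becomes a coboundary after multiplication by
`1 - e^{⟨h_o, λ⟩ δ}`. -/
theorem exists_eq_of_vanishing_on_finiteWeylGroup {o : I} (ho : C.IsZeroVertex o)
    {lam : WeightLattice I} (hlam : C.level lam = 0) {F : C.weylGroup → WeightLattice I → ℤ}
    (hF : IsFunctionCocycle F) (hfin : ∀ g, (F g).support.Finite)
    (horb : ∀ g μ, F g μ ≠ 0 → μ ∈ MulAction.orbit C.weylGroup lam)
    (hvan : ∀ v ∈ C.finiteWeylGroup o, ∀ μ, F v μ = 0) :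
    ∃ m : WeightLattice I → ℤ, m.support.Finite ∧
      (∀ μ, m μ ≠ 0 → μ ∈ MulAction.orbit C.weylGroup lam) ∧
      ∀ g μ, F g μ - F g (μ - C.coroot o lam • C.delta) = m (g⁻¹ • μ) - m μ := by
  classical
  obtain ⟨w, hw, hsw⟩ := ho.exists_smul_eq
  set n := C.coroot o lam with hn
  set s := C.simpleReflection o with hs
  set H := C.finiteWeylGroup o with hH
  have hfinH : Finite H := C.finite_finiteWeylGroup o
  set G := F s with hG
  -- `M` evaluates `G` at the representative `λ + jδ` of the finite Weyl group orbit of `μ`, so it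
  -- is invariant under that group; the primitive will be `-M`.
  set M : WeightLattice I → ℤ := fun μ =>
    if h : ∃ v ∈ H, ∃ j : ℤ, v⁻¹ • μ = lam + j • C.delta then G (h.choose⁻¹ • μ) else 0 with hM
  have hMeq : ∀ v ∈ H, ∀ j : ℤ, ∀ μ, v⁻¹ • μ = lam + j • C.delta → M μ = G (v⁻¹ • μ) := by
    intro v hv j μ hμ
    have h : ∃ v ∈ H, ∃ j : ℤ, v⁻¹ • μ = lam + j • C.delta := ⟨v, hv, j, hμ⟩
    have hMμ : M μ = G (h.choose⁻¹ • μ) := dif_pos h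
    obtain ⟨hu, k, hk⟩ := h.choose_spec
    rw [hMμ]
    congr 1
    set u := h.choose
    have h1 : (u⁻¹ * v) • (lam + j • C.delta) = lam + k • C.delta := by
      rw [← hμ, mul_smul, smul_inv_smul, hk]
    obtain ⟨q, hq, hqo⟩ := C.exists_smul_eq_add_of_mem_finiteWeylGroup
      (H.mul_mem (H.inv_mem hu) hv) (lam + j • C.delta)
    -- The finite Weyl group preserves `α_o`-coordinates and `δ` has coordinate 1 there, so the
    -- representative is unique.
    have h2 : k = j := by
      have h3 := congrFun (congrArg Prod.snd (h1.symm.trans hq)) o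
      simp [delta, ho.1, hqo] at h3
      exact h3
    rw [hk, hμ, h2]
  have hMzero : ∀ μ, (¬ ∃ v ∈ H, ∃ j : ℤ, v⁻¹ • μ = lam + j • C.delta) → M μ = 0 :=
    fun μ h => dif_neg h
  have hMne : ∀ μ, M μ ≠ 0 → ∃ v ∈ H, G (v⁻¹ • μ) ≠ 0 := by
    intro μ hμ
    by_cases h : ∃ v ∈ H, ∃ j : ℤ, v⁻¹ • μ = lam + j • C.delta
    · obtain ⟨v, hv, j, hj⟩ := h
      exact ⟨v, hv, by rwa [← hMeq v hv j μ hj]⟩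
    · exact absurd (hMzero μ h) hμ
  have hMinv : ∀ u ∈ H, ∀ μ, M (u • μ) = M μ := by
    intro u hu μ
    by_cases h : ∃ v ∈ H, ∃ j : ℤ, v⁻¹ • μ = lam + j • C.delta
    · obtain ⟨v, hv, j, hj⟩ := h
      have e : (u * v)⁻¹ • u • μ = v⁻¹ • μ := by rw [mul_inv_rev, mul_smul, inv_smul_smul]
      rw [hMeq v hv j μ hj, hMeq (u * v) (H.mul_mem hu hv) j (u • μ) (by rw [e, hj]), e]
    · rw [hMzero μ h, hMzero]
      rintro ⟨v, hv, j, hj⟩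
      refine h ⟨u⁻¹ * v, H.mul_mem (H.inv_mem hu) hv, j, ?_⟩
      rwa [mul_inv_rev, inv_inv, mul_smul]
  have hcover := ho.exists_inv_smul_eq C hlam
  have horbn : ∀ μ, μ - n • C.delta ∈ MulAction.orbit C.weylGroup lam →
      μ ∈ MulAction.orbit C.weylGroup lam :=
    (C.mul_oneSubExp_mem_orbitSubmodule (ho.add_mem_orbit C hlam)).1
  have hF' : IsFunctionCocycle fun g μ => F g μ - F g (μ - n • C.delta) := by
    intro g k μ
    simp only [hF g k, smul_sub_zsmul_delta]
    ring
  refine ⟨fun μ => -M μ, ?_, ?_, hF'.eq_coboundary_of_closure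
    (m := fun μ => -M μ) C.closure_range_simpleReflection ?_⟩
  · have h1 : (⋃ v : H, (fun μ => v.1⁻¹ • μ) ⁻¹' G.support).Finite :=
      Set.finite_iUnion fun v =>
        (hfin s).preimage (MulAction.injective (v.1⁻¹ : C.weylGroup)).injOn
    refine h1.subset fun μ hμ => ?_
    obtain ⟨v, hv, hGv⟩ := hMne μ (by simpa using hμ)
    exact Set.mem_iUnion.2 ⟨⟨v, hv⟩, hGv⟩
  · intro μ hμ
    obtain ⟨v, hv, hGv⟩ := hMne μ (by simpa using hμ)
    have := MulAction.mem_orbit_of_mem_orbit v (horb s _ hGv)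
    rwa [smul_inv_smul] at this
  · rintro _ ⟨i, rfl⟩ μ
    rw [simpleReflection_inv]
    by_cases hi : i = o
    · subst hi
      change G μ - G (μ - n • C.delta) = -M (s • μ) - -M μ
      by_cases h : ∃ v ∈ H, ∃ j : ℤ, v⁻¹ • μ = lam + j • C.delta
      · obtain ⟨v, hv, j, hj⟩ := h
        have hμ : C.level μ = 0 := by
          rw [← C.level_smul v⁻¹ μ, hj, level_add_zsmul_delta, hlam]
        -- For this `v` one shift in the relation is exactly `nδ`, and the relation reads `G μ - G
        -- (μ - nδ) = M μ - M (s • μ)`.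
        have h1 := C.add_eq_add_of_vanishing_on_finiteWeylGroup hF hvan hw hsw hv hμ
        have h2 : C.coroot i (v⁻¹ • μ) = n := by rw [hj, coroot_add_zsmul_delta]
        have h3 : M (s • μ) = G (v⁻¹ • μ - C.coroot i μ • C.delta) := by
          have e : s • μ = w • (μ - C.coroot i μ • C.delta) := by
            rw [hsw μ hμ, smul_sub_zsmul_delta]
          rw [e, hMinv w hw, hMeq v hv (j - C.coroot i μ), smul_sub_zsmul_delta]
          rw [smul_sub_zsmul_delta, hj, sub_smul, add_sub_assoc]
        rw [h3, hMeq v hv j μ hj]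
        rw [h2] at h1
        change G μ + G _ = G _ + G _ at h1
        linarith
      · have h0 : μ ∉ MulAction.orbit C.weylGroup lam := fun h' => h (hcover μ h')
        have h1 : G μ = 0 := by
          by_contra h'
          exact h0 (horb _ _ h')
        have h2 : G (μ - n • C.delta) = 0 := by
          by_contra h'
          exact h0 (horbn μ (horb _ _ h'))
        have h3 : M μ = 0 := hMzero μ h
        have h4 : M (s • μ) = 0 := by
          by_contra h'
          obtain ⟨v, hv, hGv⟩ := hMne _ h'
          have h5 := horb s _ hGv
          have h6 := MulAction.mem_orbit_of_mem_orbit (s⁻¹ * v) h5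
          rw [mul_smul, smul_inv_smul, inv_smul_smul] at h6
          exact h0 h6
        rw [h1, h2, h3, h4, sub_self, sub_self]
    · have hmem := C.simpleReflection_mem_finiteWeylGroup hi
      rw [hvan _ hmem, hvan _ hmem, hMinv _ hmem, sub_self, sub_self]

/-- The finite Weyl group has a finitely supported primitive `m₀`; subtracting its coboundary
reduces to a cocycle vanishing on that group. -/
theorem exists_orbitMul_functor_map_eq_zero {o : I} (ho : C.IsZeroVertex o)
    {lam : WeightLattice I} (hlam : C.level lam = 0) :
    ∃ h : ∀ x ∈ C.orbitSubmodule lam, C.oneSubExp (C.coroot o lam) * x ∈ C.orbitSubmodule lam,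
      (groupCohomology.functor ℤ C.weylGroup 1).map (C.orbitMul lam (C.coroot o lam) h) = 0 := by
  classical
  set n := C.coroot o lam with hn
  obtain ⟨horbn, hmul⟩ := C.mul_oneSubExp_mem_orbitSubmodule (ho.add_mem_orbit C hlam)
  refine ⟨hmul, functor_one_map_eq_zero _ fun f hf => ?_⟩
  have hF := C.isFunctionCocycle_of_orbitRep lam f hf
  set F : C.weylGroup → WeightLattice I → ℤ :=
    fun g μ => (f g : C.orbitSubmodule lam).1.coeff μ with hFdef
  have hFfin : ∀ g, (F g).support.Finite := fun g =>
    (f g : C.orbitSubmodule lam).1.coeff.hasFiniteSupport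
  have hForb : ∀ g μ, F g μ ≠ 0 → μ ∈ MulAction.orbit C.weylGroup lam := fun g =>
    (C.mem_orbitSubmodule_iff lam _).1 (f g : C.orbitSubmodule lam).2
  have hfinH : Finite (C.finiteWeylGroup o) := C.finite_finiteWeylGroup o
  have hFH : IsFunctionCocycle fun (v : C.finiteWeylGroup o) μ => F v.1 μ :=
    fun u v μ => hF u.1 v.1 μ
  obtain ⟨m₀, hm₀, hsupp₀⟩ := hFH.exists_eq_of_finite
  have hm₀fin : m₀.support.Finite :=
    (Set.finite_iUnion fun v : C.finiteWeylGroup o => hFfin v.1).subset fun μ hμ => by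
      obtain ⟨v, hv⟩ := hsupp₀ μ hμ
      exact Set.mem_iUnion.2 ⟨v, hv⟩
  have hm₀orb : ∀ μ, m₀ μ ≠ 0 → μ ∈ MulAction.orbit C.weylGroup lam := fun μ hμ => by
    obtain ⟨v, hv⟩ := hsupp₀ μ hμ
    exact hForb _ _ hv
  have horbi : ∀ (g : C.weylGroup) μ, g⁻¹ • μ ∈ MulAction.orbit C.weylGroup lam →
      μ ∈ MulAction.orbit C.weylGroup lam := fun g μ h => by
    have := MulAction.mem_orbit_of_mem_orbit g h
    rwa [smul_inv_smul] at this
  obtain ⟨m, hmfin, hmorb, hm⟩ := C.exists_eq_of_vanishing_on_finiteWeylGroup ho hlam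
    (hF.sub_coboundary m₀)
    (fun g => ((hFfin g).union ((hm₀fin.preimage
      (MulAction.injective g⁻¹).injOn).union hm₀fin)).subset fun μ hμ => by
      by_contra h
      simp only [Set.mem_union, not_or, Set.mem_preimage, Function.mem_support, not_not] at h
      exact hμ (by simp only [h.1, h.2.1, h.2.2, sub_self]))
    (fun g μ hμ => by
      by_contra h
      have h1 : F g μ = 0 := by by_contra h'; exact h (hForb g μ h')
      have h2 : m₀ μ = 0 := by by_contra h'; exact h (hm₀orb μ h')
      have h3 : m₀ (g⁻¹ • μ) = 0 := by by_contra h'; exact h (horbi g μ (hm₀orb _ h'))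
      exact hμ (by simp only [h1, h2, h3, sub_self]))
    (fun v hv μ => sub_eq_zero.2 (hm₀ ⟨v, hv⟩ μ))
  -- The subtracted coboundary is restored after multiplication by `1 - e^{nδ}`, which commutes with
  -- `W`.
  set m₁ : WeightLattice I → ℤ := fun μ => m μ + (m₀ μ - m₀ (μ - n • C.delta)) with hm₁
  have hm₁fin : m₁.support.Finite := by
    refine (hmfin.union (hm₀fin.union (hm₀fin.preimage
      (f := fun μ => μ - n • C.delta) (sub_left_injective).injOn))).subset fun μ hμ => ?_
    by_contra h
    simp only [Set.mem_union, not_or, Set.mem_preimage, Function.mem_support, not_not] at h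
    exact hμ (by simp only [hm₁, h.1, h.2.1, h.2.2, sub_self, add_zero])
  have hm₁orb : ∀ μ, m₁ μ ≠ 0 → μ ∈ MulAction.orbit C.weylGroup lam := fun μ hμ => by
    by_contra h
    have h1 : m μ = 0 := by by_contra h'; exact h (hmorb μ h')
    have h2 : m₀ μ = 0 := by by_contra h'; exact h (hm₀orb μ h')
    have h3 : m₀ (μ - n • C.delta) = 0 := by by_contra h'; exact h (horbn μ (hm₀orb _ h'))
    exact hμ (by simp only [hm₁, h1, h2, h3, sub_self, add_zero])
  refine ⟨C.orbitElement lam m₁ hm₁fin hm₁orb, fun g =>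
    C.eq_rho_orbitElement_sub lam hm₁fin hm₁orb g _ fun μ => ?_⟩
  have h1 := hm g μ
  refine (C.oneSubExp_mul_coeff n (f g : C.orbitSubmodule lam).1 μ).trans ?_
  change F g μ - F g (μ - n • C.delta) = _
  simp only [hm₁, smul_sub_zsmul_delta] at h1 ⊢
  linarith

end AffineCartanMatrix

end

theorem proposition5p3 {I : Type} [Fintype I] [DecidableEq I] (C : AffineCartanMatrix I) :
    (∀ J : Set I, J ≠ Set.univ →
      Subsingleton (groupCohomology.H1 (C.weightRingRep J))) ∧
    (∀ lam : WeightLattice I, C.level lam ≠ 0 → (¬ C.IsRegular lam ∨ 2 < Fintype.card I) →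
      Subsingleton (groupCohomology.H1 (C.orbitRep lam))) ∧
    (∀ o : I, C.IsZeroVertex o → ∀ lam : WeightLattice I, C.level lam = 0 →
      (∀ i, i ≠ o → 0 ≤ C.coroot i lam) →
      ∃ h : ∀ x ∈ C.orbitSubmodule lam,
          C.oneSubExp (C.coroot o lam) * x ∈ C.orbitSubmodule lam,
        (groupCohomology.functor ℤ C.weylGroup 1).map
          (C.orbitMul lam (C.coroot o lam) h) = 0) :=
  ⟨fun _ hJ => C.subsingleton_H1_weightRingRep hJ,
    fun _ hlam h => C.subsingleton_H1_orbitRep hlam h,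
    fun _ ho _ hlam _ => C.exists_orbitMul_functor_map_eq_zero ho hlam⟩
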